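/- Let $E$ and $F$ be row-finite directed graphs (each vertex emits only finitely many edges), let $k$ be a field, and let $L(E)=L_k(E)$ and $L(F)=L_k(F)$ be the Leavitt path algebras with their canonical $\mathbb Z$-gradings (vertices in degree $0$, edges in degree $1$, ghost edges in degree $-1$). For a not necessarily unital $\mathbb Z$-graded ring $R$, let $\mathcal V^{\mathrm{gr}}(R)$ be the commutative monoid of graded equivalence classes of homogeneous idempotent matrices over $R$ (for unital $R$, the monoid of isomorphism classes of graded finitely generated projective modules), on which $\mathbb Z$ acts by shifting degrees. Let $K_0^{\mathrm{gr}}(R)$ be its group completion, regarded as a $\mathbb Z[x,x^{-1}]$-module via the shift and pre-ordered by the positive cone, i.e. the image of $\mathcal V^{\mathrm{gr}}(R)$. For a graded two-sided ideal $I$ of $L(E)$, regard $\mathcal V^{\mathrm{gr}}(I)$ as a subset of $K_0^{\mathrm{gr}}(L(E))$ via the map induced by the inclusion $I\subseteq L(E)$, and similarly for $F$. Let $\mathscr L^{\mathrm{gr}}(L(E))$ be the lattice of graded two-sided ideals of $L(E)$. Let $\operatorname{Spec}^{\mathrm{gr}}(L(E))$ be the set of graded prime ideals, i.e. of the graded ideals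 $\mathfrak p\neq L(E)$ such that, for all graded ideals $I,J$, $IJ\subseteq\mathfrak p$ implies $I\subseteq\mathfrak p$ or $J\subseteq\mathfrak p$. It carries the Jacobson topology, whose open sets are the sets $W(I)=\{\mathfrak p : I\not\subseteq\mathfrak p\}$ with $I$ a graded ideal. Suppose that $\varphi\colon K_0^{\mathrm{gr}}(L(E))\to K_0^{\mathrm{gr}}(L(F))$ is an isomorphism of $\mathbb Z[x,x^{-1}]$-modules such that $\varphi$ and $\varphi^{-1}$ are order-preserving. Then there is a lattice isomorphism $$\Phi\colon \mathscr L^{\mathrm{gr}}(L(E))\longrightarrow \mathscr L^{\mathrm{gr}}(L(F))$$ such that $\mathcal V^{\mathrm{gr}}(\Phi(I))=\varphi(\mathcal V^{\mathrm{gr}}(I))$ for every graded ideal $I$ of $L(E)$, and $\Phi$ restricts to a homeomorphism $\operatorname{Spec}^{\mathrm{gr}}(L(E))\to\operatorname{Spec}^{\mathrm{gr}}(L(F))$. -/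

import Mathlib

noncomputable section

set_option linter.unusedSectionVars false

/-! ## Directed graphs and Leavitt path algebras -/

/-- A directed graph with vertex set `V`, edge set `E`, source map `s` and range map `r`. -/
structure DirGraph (V E : Type*) where
  s : E → V
  r : E → V

/-- Every vertex emits only finitely many edges. -/
def DirGraph.RowFinite {V E : Type*} (G : DirGraph V E) : Prop :=
  ∀ v, {e | G.s e = v}.Finite

/-- The generators `v`, `e`, `e*` of a Leavitt path algebra. -/
inductive LGen (V E : Type*) where
  | vertex (v : V)
  | edge (e : E)
  | ghost (e : E)

/-- The degrees of the generators: `0` for `v`, `1` for `e`, `-1` for `e*`. -/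
def LGen.degree {V E : Type*} : LGen V E → ℤ
  | vertex _ => 0
  | edge _ => 1
  | ghost _ => -1

/-- The free associative (not necessarily unital) `k`-algebra on the generators: linear
combinations of nonempty words. -/
abbrev FreeLPA (k : Type*) [Field k] (V E : Type*) : Type _ :=
  MonoidAlgebra k (FreeSemigroup (LGen V E))

namespace FreeLPA

variable (k : Type*) [Field k] {V E : Type*}

/-- A word, as an element of the free algebra. -/
def word (w : FreeSemigroup (LGen V E)) : FreeLPA k V E := MonoidAlgebra.single w 1

/-- A generator, as an element of the free algebra. -/
def gen (x : LGen V E) : FreeLPA k V E := word k (FreeSemigroup.of x)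

/-- The degree of a word: the sum of the degrees of its letters. -/
def wordDegree (w : FreeSemigroup (LGen V E)) : ℤ :=
  (FreeSemigroup.lift (fun x : LGen V E => Multiplicative.ofAdd x.degree) w).toAdd

end FreeLPA

open FreeLPA in
/-- The defining relations of the Leavitt path algebra (the last one is imposed at every
vertex that emits a nonzero finite number of edges). -/
inductive LRel (k : Type*) [Field k] {V E : Type*} (G : DirGraph V E) :
    FreeLPA k V E → FreeLPA k V E → Prop
  | vertex_self (v : V) : LRel k G (gen k (.vertex v) * gen k (.vertex v)) (gen k (.vertex v))
  | vertex_ne (v w : V) (h : v ≠ w) : LRel k G (gen k (.vertex v) * gen k (.vertex w)) 0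
  | source_edge (e : E) : LRel k G (gen k (.vertex (G.s e)) * gen k (.edge e)) (gen k (.edge e))
  | edge_range (e : E) : LRel k G (gen k (.edge e) * gen k (.vertex (G.r e))) (gen k (.edge e))
  | range_ghost (e : E) :
      LRel k G (gen k (.vertex (G.r e)) * gen k (.ghost e)) (gen k (.ghost e))
  | ghost_source (e : E) :
      LRel k G (gen k (.ghost e) * gen k (.vertex (G.s e))) (gen k (.ghost e))
  | ghost_edge_self (e : E) :
      LRel k G (gen k (.ghost e) * gen k (.edge e)) (gen k (.vertex (G.r e)))
  | ghost_edge_ne (e f : E) (h : e ≠ f) : LRel k G (gen k (.ghost e) * gen k (.edge f)) 0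
  | vertex_sum (v : V) (hfin : {e | G.s e = v}.Finite) (hne : {e | G.s e = v}.Nonempty) :
      LRel k G (gen k (.vertex v)) (∑ e ∈ hfin.toFinset, gen k (.edge e) * gen k (.ghost e))

/-- The congruence of `k`-algebras generated by the defining relations. (In an algebra without
unit, a ring congruence need not respect scalars; hence the scalar multiples.) -/
def lpaCon (k : Type*) [Field k] {V E : Type*} (G : DirGraph V E) : RingCon (FreeLPA k V E) :=
  ringConGen fun a b => ∃ (c : k) (a' b' : FreeLPA k V E), LRel k G a' b' ∧ a = c • a' ∧ b = c • b'

/-- The Leavitt path algebra `L_k(G)`. -/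
def LPA (k : Type*) [Field k] {V E : Type*} (G : DirGraph V E) : Type _ :=
  (lpaCon k G).Quotient

namespace LPA

variable (k : Type*) [Field k] {V E : Type*} (G : DirGraph V E)

instance : NonUnitalRing (LPA k G) := inferInstanceAs (NonUnitalRing (lpaCon k G).Quotient)

/-- The quotient map from the free algebra. -/
def mk : FreeLPA k V E →ₙ+* LPA k G where
  toFun a := ((a : (lpaCon k G).Quotient))
  map_zero' := rfl
  map_add' _ _ := rfl
  map_mul' _ _ := rfl

theorem mk_surjective : Function.Surjective (mk k G) := Quotient.mk''_surjective

theorem con_smul (c : k) {a b : FreeLPA k V E} (h : lpaCon k G a b) :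
    lpaCon k G (c • a) (c • b) := by
  induction h with
  | of x y h =>
    obtain ⟨d, a', b', h, rfl, rfl⟩ := h
    exact RingConGen.Rel.of _ _ ⟨c * d, a', b', h, smul_smul .., smul_smul ..⟩
  | refl x => exact RingConGen.Rel.refl _
  | symm _ ih => exact RingConGen.Rel.symm ih
  | trans _ _ ih₁ ih₂ => exact RingConGen.Rel.trans ih₁ ih₂
  | add _ _ ih₁ ih₂ => rw [smul_add, smul_add]; exact RingConGen.Rel.add ih₁ ih₂
  | mul _ h₂ ih₁ _ => rw [← smul_mul_assoc, ← smul_mul_assoc]; exact RingConGen.Rel.mul ih₁ h₂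

instance : SMul k (LPA k G) where
  smul c := Quotient.map' (c • ·) fun _ _ h => con_smul k G c h

theorem mk_smul (c : k) (a : FreeLPA k V E) : mk k G (c • a) = c • mk k G a := rfl

instance : Module k (LPA k G) :=
  Function.Surjective.module k (mk k G).toAddMonoidHom (mk_surjective k G) (mk_smul k G)

instance : IsScalarTower k (LPA k G) (LPA k G) where
  smul_assoc c x y := by
    obtain ⟨a, rfl⟩ := mk_surjective k G x
    obtain ⟨b, rfl⟩ := mk_surjective k G y
    simp only [smul_eq_mul, ← mk_smul, ← map_mul, smul_mul_assoc]

instance : SMulCommClass k (LPA k G) (LPA k G) where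
  smul_comm c x y := by
    obtain ⟨a, rfl⟩ := mk_surjective k G x
    obtain ⟨b, rfl⟩ := mk_surjective k G y
    simp only [smul_eq_mul, ← mk_smul, ← map_mul, mul_smul_comm]

/-- The component of degree `n` of the canonical `ℤ`-grading of `L_k(G)`: the `k`-span of the
monomials of degree `n`. -/
def grading (n : ℤ) : AddSubgroup (LPA k G) :=
  (Submodule.span k {a | ∃ w, FreeLPA.wordDegree w = n ∧ a = mk k G (FreeLPA.word k w)}).toAddSubgroup

instance : SetLike.GradedMul (grading k G) where
  mul_mem := by
    intro i j a b ha hb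
    simp only [grading, Submodule.mem_toAddSubgroup] at ha hb ⊢
    induction ha using Submodule.span_induction with
    | zero => rw [zero_mul]; exact zero_mem _
    | add x y _ _ hx hy => rw [add_mul]; exact add_mem hx hy
    | smul c x _ hx => rw [smul_mul_assoc]; exact Submodule.smul_mem _ _ hx
    | mem x hx =>
      obtain ⟨w, rfl, rfl⟩ := hx
      induction hb using Submodule.span_induction with
      | zero => rw [mul_zero]; exact zero_mem _
      | add x y _ _ hx hy => rw [mul_add]; exact add_mem hx hy
      | smul c x _ hx => rw [mul_smul_comm]; exact Submodule.smul_mem _ _ hx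
      | mem x hx =>
        obtain ⟨w', rfl, rfl⟩ := hx
        refine Submodule.subset_span ⟨w * w', ?_, ?_⟩
        · simp [FreeLPA.wordDegree, map_mul]
        · rw [← map_mul]; simp [FreeLPA.word]

theorem mem_closure_grading (a : LPA k G) :
    a ∈ AddSubgroup.closure {b | ∃ n, b ∈ grading k G n} := by
  obtain ⟨a, rfl⟩ := mk_surjective k G a
  induction a using MonoidAlgebra.induction_linear with
  | zero => rw [map_zero]; exact zero_mem _
  | add x y hx hy => rw [map_add]; exact add_mem hx hy
  | single w c =>
    refine AddSubgroup.subset_closure ⟨FreeLPA.wordDegree w, ?_⟩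
    have : (MonoidAlgebra.single w c : FreeLPA k V E) = c • FreeLPA.word k w := by
      simp [FreeLPA.word]
    rw [this, mk_smul]
    exact Submodule.smul_mem _ c (Submodule.subset_span ⟨w, rfl, rfl⟩)

end LPA

/-! ## Graded ideals and the graded prime spectrum -/

/-- A two-sided ideal is graded if each of its elements is a sum of homogeneous elements of the
ideal. -/
def TwoSidedIdeal.IsGraded {R : Type*} [NonUnitalRing R] (𝒜 : ℤ → AddSubgroup R)
    (I : TwoSidedIdeal R) : Prop :=
  ∀ a ∈ I, a ∈ AddSubgroup.closure {b | b ∈ I ∧ ∃ n, b ∈ 𝒜 n}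

/-- The lattice `ℒ^gr(L_k(G))` of graded two-sided ideals, ordered by inclusion. (A lattice
isomorphism is the same thing as an order isomorphism `≃o` of the underlying posets.) -/
def GradedIdeal (k : Type*) [Field k] {V E : Type*} (G : DirGraph V E) : Type _ :=
  {I : TwoSidedIdeal (LPA k G) // I.IsGraded (LPA.grading k G)}

namespace GradedIdeal

variable {k : Type*} [Field k] {V E : Type*} {G : DirGraph V E}

instance : PartialOrder (GradedIdeal k G) := inferInstanceAs (PartialOrder (Subtype _))

/-- The underlying two-sided ideal. -/
def ideal (I : GradedIdeal k G) : TwoSidedIdeal (LPA k G) := I.1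

theorem le_iff {I J : GradedIdeal k G} : I ≤ J ↔ ∀ a ∈ I.ideal, a ∈ J.ideal := Iff.rfl

/-- The sums of homogeneous elements of an ideal. -/
def homogSums (J : TwoSidedIdeal (LPA k G)) : AddSubgroup (LPA k G) :=
  AddSubgroup.closure {b | b ∈ J ∧ ∃ n, b ∈ LPA.grading k G n}

theorem homogSums_mono {I J : TwoSidedIdeal (LPA k G)} (h : ∀ a ∈ I, a ∈ J) :
    homogSums I ≤ homogSums J :=
  AddSubgroup.closure_mono fun b hb => ⟨h b hb.1, hb.2⟩

theorem mul_mem_homogSums_left {J : TwoSidedIdeal (LPA k G)} {x y : LPA k G}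
    (hy : y ∈ homogSums J) : x * y ∈ homogSums J := by
  induction hy using AddSubgroup.closure_induction with
  | zero => rw [mul_zero]; exact zero_mem _
  | add y z _ _ hy hz => rw [mul_add]; exact add_mem hy hz
  | neg y _ hy => rw [mul_neg]; exact neg_mem hy
  | mem y hy =>
    obtain ⟨hyJ, n, hn⟩ := hy
    induction LPA.mem_closure_grading k G x using AddSubgroup.closure_induction with
    | zero => rw [zero_mul]; exact zero_mem _
    | add y z _ _ hy hz => rw [add_mul]; exact add_mem hy hz
    | neg y _ hy => rw [neg_mul]; exact neg_mem hy
    | mem x hx =>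
      obtain ⟨m, hm⟩ := hx
      exact AddSubgroup.subset_closure
        ⟨J.mul_mem_left _ _ hyJ, m + n, SetLike.GradedMul.mul_mem hm hn⟩

theorem mul_mem_homogSums_right {J : TwoSidedIdeal (LPA k G)} {x y : LPA k G}
    (hx : x ∈ homogSums J) : x * y ∈ homogSums J := by
  induction hx using AddSubgroup.closure_induction with
  | zero => rw [zero_mul]; exact zero_mem _
  | add y z _ _ hy hz => rw [add_mul]; exact add_mem hy hz
  | neg y _ hy => rw [neg_mul]; exact neg_mem hy
  | mem x hx =>
    obtain ⟨hxJ, m, hm⟩ := hx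
    induction LPA.mem_closure_grading k G y using AddSubgroup.closure_induction with
    | zero => rw [mul_zero]; exact zero_mem _
    | add y z _ _ hy hz => rw [mul_add]; exact add_mem hy hz
    | neg y _ hy => rw [mul_neg]; exact neg_mem hy
    | mem y hy =>
      obtain ⟨n, hn⟩ := hy
      exact AddSubgroup.subset_closure
        ⟨J.mul_mem_right _ _ hxJ, m + n, SetLike.GradedMul.mul_mem hm hn⟩

/-- `homogSums J` as a two-sided ideal. -/
def coreIdeal (J : TwoSidedIdeal (LPA k G)) : TwoSidedIdeal (LPA k G) :=
  TwoSidedIdeal.mk' (homogSums J : Set (LPA k G)) (zero_mem _) add_mem neg_mem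
    mul_mem_homogSums_left mul_mem_homogSums_right

theorem mem_coreIdeal {J : TwoSidedIdeal (LPA k G)} {a : LPA k G} :
    a ∈ coreIdeal J ↔ a ∈ homogSums J := by
  rw [coreIdeal, TwoSidedIdeal.mem_mk', SetLike.mem_coe]

/-- The largest graded ideal contained in a given two-sided ideal. -/
def core (J : TwoSidedIdeal (LPA k G)) : GradedIdeal k G :=
  ⟨coreIdeal J, fun a ha => by
    have ha' : a ∈ homogSums J := mem_coreIdeal.1 ha
    refine AddSubgroup.closure_mono (fun b hb => ?_) ha'
    exact ⟨mem_coreIdeal.2 (AddSubgroup.subset_closure hb), hb.2⟩⟩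

theorem mem_core {J : TwoSidedIdeal (LPA k G)} {a : LPA k G} :
    a ∈ (core J).ideal ↔ a ∈ homogSums J := mem_coreIdeal

theorem core_le (J : TwoSidedIdeal (LPA k G)) : (core J).ideal ≤ J := by
  intro a ha
  exact (AddSubgroup.closure_le (AddSubgroup.ofClass J)).2 (fun b hb => hb.1) (mem_core.1 ha)

theorem le_core {I : GradedIdeal k G} {J : TwoSidedIdeal (LPA k G)} (h : I.ideal ≤ J) :
    I ≤ core J := fun a ha =>
  mem_core.2 (homogSums_mono h (I.2 a ha))

theorem mul_mem_core {I J : GradedIdeal k G} {a b : LPA k G} (ha : a ∈ I.ideal)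
    (hb : b ∈ J.ideal) : a * b ∈ (core (I.ideal ⊓ J.ideal)).ideal := by
  rw [mem_core]
  have ha' := I.2 a ha
  clear ha
  induction ha' using AddSubgroup.closure_induction with
  | zero => rw [zero_mul]; exact zero_mem _
  | add y z _ _ hy hz => rw [add_mul]; exact add_mem hy hz
  | neg y _ hy => rw [neg_mul]; exact neg_mem hy
  | mem x hx =>
    have hb' := J.2 b hb
    clear hb
    induction hb' using AddSubgroup.closure_induction with
    | zero => rw [mul_zero]; exact zero_mem _
    | add y z _ _ hy hz => rw [mul_add]; exact add_mem hy hz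
    | neg y _ hy => rw [mul_neg]; exact neg_mem hy
    | mem y hy =>
      obtain ⟨hxI, m, hm⟩ := hx
      obtain ⟨hyJ, n, hn⟩ := hy
      exact AddSubgroup.subset_closure ⟨⟨I.ideal.mul_mem_right _ _ hxI,
        J.ideal.mul_mem_left _ _ hyJ⟩, m + n, SetLike.GradedMul.mul_mem hm hn⟩

theorem top_isGraded : (⊤ : TwoSidedIdeal (LPA k G)).IsGraded (LPA.grading k G) := by
  intro a _
  refine AddSubgroup.closure_mono (fun b hb => ?_) (LPA.mem_closure_grading k G a)
  exact ⟨trivial, hb⟩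

/-- The join is the sum `I + J`; the meet is the greatest lower bound, the largest graded ideal
contained in `I ∩ J`. -/
instance : Lattice (GradedIdeal k G) where
  sup I J := ⟨I.ideal ⊔ J.ideal, fun a ha => by
    have h : I.ideal ⊔ J.ideal ≤ (core (I.ideal ⊔ J.ideal)).ideal :=
      sup_le (le_core le_sup_left) (le_core le_sup_right)
    exact mem_core.1 (h ha)⟩
  le_sup_left I J := fun _ ha => (le_sup_left : I.ideal ≤ I.ideal ⊔ J.ideal) ha
  le_sup_right I J := fun _ ha => (le_sup_right : J.ideal ≤ I.ideal ⊔ J.ideal) ha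
  sup_le I J K h h' := fun _ ha => (sup_le h h' : I.ideal ⊔ J.ideal ≤ K.ideal) ha
  inf I J := core (I.ideal ⊓ J.ideal)
  inf_le_left I J := fun _ ha => (core_le _ ha).1
  inf_le_right I J := fun _ ha => (core_le _ ha).2
  le_inf I J K h h' := le_core (le_inf h h' : I.ideal ≤ J.ideal ⊓ K.ideal)

/-- A graded ideal `P ≠ L_k(G)` is graded prime if `I J ⊆ P` implies `I ⊆ P` or `J ⊆ P` for all
graded ideals `I`, `J`. -/
def IsPrime (P : GradedIdeal k G) : Prop :=
  P.ideal ≠ ⊤ ∧ ∀ I J : GradedIdeal k G,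
    (∀ a ∈ I.ideal, ∀ b ∈ J.ideal, a * b ∈ P.ideal) → I ≤ P ∨ J ≤ P

end GradedIdeal

/-- The set `Spec^gr(L_k(G))` of graded prime ideals. -/
def GrSpec (k : Type*) [Field k] {V E : Type*} (G : DirGraph V E) : Type _ :=
  {P : GradedIdeal k G // P.IsPrime}

namespace GrSpec

variable {k : Type*} [Field k] {V E : Type*} {G : DirGraph V E}

/-- The underlying graded ideal. -/
def toGradedIdeal (P : GrSpec k G) : GradedIdeal k G := P.1

/-- `W(I) = {P | I ⊄ P}`. -/
def W (I : GradedIdeal k G) : Set (GrSpec k G) := {P | ¬ I ≤ P.toGradedIdeal}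

/-- The Jacobson topology: the open sets are exactly the sets `W(I)`, `I` a graded ideal. -/
instance : TopologicalSpace (GrSpec k G) where
  IsOpen U := ∃ I, U = W I
  isOpen_univ := by
    refine ⟨⟨⊤, GradedIdeal.top_isGraded⟩, (Set.eq_univ_of_forall fun P hP => P.2.1 ?_).symm⟩
    exact top_le_iff.1 (show (⊤ : TwoSidedIdeal (LPA k G)) ≤ P.toGradedIdeal.ideal from hP)
  isOpen_inter := by
    rintro _ _ ⟨I, rfl⟩ ⟨J, rfl⟩
    refine ⟨GradedIdeal.core (I.ideal ⊓ J.ideal), ?_⟩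
    ext P
    constructor
    · rintro ⟨hI, hJ⟩ hP
      exact (P.2.2 I J fun a ha b hb => hP (GradedIdeal.mul_mem_core ha hb)).elim hI hJ
    · intro h
      exact ⟨fun hI => h fun a ha => hI (GradedIdeal.core_le _ ha).1,
        fun hJ => h fun a ha => hJ (GradedIdeal.core_le _ ha).2⟩
  isOpen_sUnion := by
    intro S hS
    refine ⟨GradedIdeal.core (sSup {I | ∃ J : GradedIdeal k G, W J ∈ S ∧ J.ideal = I}), ?_⟩
    ext P
    constructor
    · rintro ⟨U, hU, hPU⟩ hP
      obtain ⟨I, rfl⟩ := hS U hU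
      have hI : I.ideal ∈ {I | ∃ J : GradedIdeal k G, W J ∈ S ∧ J.ideal = I} := ⟨I, hU, rfl⟩
      exact hPU (le_trans (GradedIdeal.le_core (le_sSup hI)) hP)
    · intro hP
      by_contra hne
      refine hP ?_
      have : sSup {I | ∃ J : GradedIdeal k G, W J ∈ S ∧ J.ideal = I} ≤ P.toGradedIdeal.ideal := by
        refine sSup_le ?_
        rintro _ ⟨J, hJ, rfl⟩
        by_contra h
        exact hne ⟨W J, hJ, h⟩
      exact fun a ha => this (GradedIdeal.core_le _ ha)

end GrSpec

/-! ## The graded monoid `V^gr` and the graded Grothendieck group `K_0^gr` -/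

section GradedEquivalence

variable {R : Type*} [NonUnitalRing R] (𝒜 : ℤ → AddSubgroup R)
  {ι κ τ ι' κ' : Type*} [Fintype ι] [Fintype κ] [Fintype τ] [Fintype ι'] [Fintype κ']

/-- The matrix `x`, with entries `x i j` of degree `σ j - δ i`, is homogeneous of degree zero as a
(right multiplication) map `R(δ₁) ⊕ ⋯ ⊕ R(δₙ) → R(σ₁) ⊕ ⋯ ⊕ R(σₘ)`. -/
def IsDegZero (δ : ι → ℤ) (σ : κ → ℤ) (x : Matrix ι κ R) : Prop := ∀ i j, x i j ∈ 𝒜 (σ j - δ i)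

/-- Graded equivalence of homogeneous idempotents: `p = x y` and `q = y x` for some homogeneous
matrices `x`, `y` of degree zero. -/
def GradedEquiv (δ : ι → ℤ) (σ : κ → ℤ) (p : Matrix ι ι R) (q : Matrix κ κ R) : Prop :=
  ∃ (x : Matrix ι κ R) (y : Matrix κ ι R),
    IsDegZero 𝒜 δ σ x ∧ IsDegZero 𝒜 σ δ y ∧ x * y = p ∧ y * x = q

variable {𝒜} {δ : ι → ℤ} {σ : κ → ℤ} {θ : τ → ℤ} {δ' : ι' → ℤ} {σ' : κ' → ℤ}
  {p : Matrix ι ι R} {q : Matrix κ κ R} {r : Matrix τ τ R}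
  {p' : Matrix ι' ι' R} {q' : Matrix κ' κ' R}

theorem IsDegZero.mul [SetLike.GradedMul 𝒜] {x : Matrix ι κ R} {y : Matrix κ τ R}
    (hx : IsDegZero 𝒜 δ σ x) (hy : IsDegZero 𝒜 σ θ y) : IsDegZero 𝒜 δ θ (x * y) := by
  intro i j
  rw [Matrix.mul_apply]
  refine sum_mem fun l _ => ?_
  have := SetLike.GradedMul.mul_mem (hx i l) (hy l j)
  rwa [show σ l - δ i + (θ j - σ l) = θ j - δ i by ring] at this

theorem IsDegZero.fromBlocks {x : Matrix ι κ R} {y : Matrix ι' κ' R} (hp : IsDegZero 𝒜 δ σ x)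
    (hq : IsDegZero 𝒜 δ' σ' y) :
    IsDegZero 𝒜 (Sum.elim δ δ') (Sum.elim σ σ') (Matrix.fromBlocks x 0 0 y) := by
  rintro (i | i) (j | j)
  exacts [hp i j, zero_mem _, zero_mem _, hq i j]

theorem GradedEquiv.symm (h : GradedEquiv 𝒜 δ σ p q) : GradedEquiv 𝒜 σ δ q p := by
  obtain ⟨x, y, hx, hy, hxy, hyx⟩ := h
  exact ⟨y, x, hy, hx, hyx, hxy⟩

theorem GradedEquiv.trans [SetLike.GradedMul 𝒜] (hp : p * p = p) (hr : r * r = r)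
    (h : GradedEquiv 𝒜 δ σ p q) (h' : GradedEquiv 𝒜 σ θ q r) : GradedEquiv 𝒜 δ θ p r := by
  obtain ⟨x, y, hx, hy, hxy, hyx⟩ := h
  obtain ⟨z, w, hz, hw, hzw, hwz⟩ := h'
  refine ⟨x * z, w * y, hx.mul hz, hw.mul hy, ?_, ?_⟩
  · calc x * z * (w * y) = x * (z * w) * y := by simp only [Matrix.mul_assoc]
      _ = (x * y) * (x * y) := by rw [hzw, ← hyx]; simp only [Matrix.mul_assoc]
      _ = p := by rw [hxy, hp]
  · calc w * y * (x * z) = w * (y * x) * z := by simp only [Matrix.mul_assoc]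
      _ = (w * z) * (w * z) := by rw [hyx, ← hzw]; simp only [Matrix.mul_assoc]
      _ = r := by rw [hwz, hr]

theorem GradedEquiv.of_equiv (e : ι ≃ κ) (hd : IsDegZero 𝒜 δ δ p) (hp : p * p = p)
    (hσ : ∀ i, σ (e i) = δ i) (hq : ∀ i j, q (e i) (e j) = p i j) : GradedEquiv 𝒜 δ σ p q := by
  have hq' : q = p.submatrix e.symm e.symm := by
    ext i j; rw [Matrix.submatrix_apply, ← hq]; simp
  have hσ' : ∀ j, σ j = δ (e.symm j) := fun j => by rw [← hσ]; simp
  refine ⟨p.submatrix id e.symm, p.submatrix e.symm id, fun i j => ?_, fun i j => ?_, ?_, ?_⟩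
  · rw [hσ']; exact hd _ _
  · rw [hσ']; exact hd _ _
  · rw [Matrix.submatrix_mul_equiv, hp]; rfl
  · rw [hq']
    conv_rhs => rw [← hp]
    rw [← Matrix.submatrix_mul p p e.symm id e.symm Function.bijective_id]

theorem GradedEquiv.fromBlocks (h : GradedEquiv 𝒜 δ σ p q) (h' : GradedEquiv 𝒜 δ' σ' p' q') :
    GradedEquiv 𝒜 (Sum.elim δ δ') (Sum.elim σ σ') (Matrix.fromBlocks p 0 0 p')
      (Matrix.fromBlocks q 0 0 q') := by
  obtain ⟨x, y, hx, hy, hxy, hyx⟩ := h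
  obtain ⟨z, w, hz, hw, hzw, hwz⟩ := h'
  refine ⟨_, _, hx.fromBlocks hz, hy.fromBlocks hw, ?_, ?_⟩ <;>
    simp [Matrix.fromBlocks_multiply, *]

theorem fromBlocks_idem (hp : p * p = p) (hq : q * q = q) :
    Matrix.fromBlocks p 0 0 q * Matrix.fromBlocks p 0 0 q = Matrix.fromBlocks p 0 0 q := by
  simp [Matrix.fromBlocks_multiply, hp, hq]

theorem map_matrix_mul {S : Type*} [NonUnitalRing S] (f : R →ₙ+* S) (x : Matrix ι κ R)
    (y : Matrix κ τ R) : (x * y).map f = x.map f * y.map f := by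
  ext i j
  simp [Matrix.mul_apply, map_sum]

end GradedEquivalence

/-- A homogeneous idempotent `p ∈ M_n(R)(δ)_0`, where `M_n(R)(δ)_0` consists of the matrices whose
`(i, j)` entry lies in `R_{δ j - δ i}`. If `R` is unital it represents the graded finitely
generated projective left module `(R(δ₁) ⊕ ⋯ ⊕ R(δₙ)) p`. -/
structure GradedIdem {R : Type*} [NonUnitalRing R] (𝒜 : ℤ → AddSubgroup R) where
  n : ℕ
  δ : Fin n → ℤ
  p : Matrix (Fin n) (Fin n) R
  degZero : IsDegZero 𝒜 δ δ p
  idem : p * p = p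

namespace GradedIdem

variable {R : Type*} [NonUnitalRing R] {𝒜 : ℤ → AddSubgroup R}

/-- Graded equivalence (isomorphism of the corresponding graded modules). -/
def Rel (a b : GradedIdem 𝒜) : Prop := GradedEquiv 𝒜 a.δ b.δ a.p b.p

instance setoid (𝒜 : ℤ → AddSubgroup R) [SetLike.GradedMul 𝒜] : Setoid (GradedIdem 𝒜) where
  r := Rel
  iseqv :=
    { refl := fun a => ⟨a.p, a.p, a.degZero, a.degZero, a.idem, a.idem⟩
      symm := fun h => GradedEquiv.symm h
      trans := fun {a _ c} h h' => GradedEquiv.trans a.idem c.idem h h' }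

/-- The empty matrix. -/
def zero (𝒜 : ℤ → AddSubgroup R) : GradedIdem 𝒜 where
  n := 0
  δ := Fin.elim0
  p := 0
  degZero := fun i => i.elim0
  idem := by simp

/-- The block diagonal sum `diag(p, q)`. -/
def add (a b : GradedIdem 𝒜) : GradedIdem 𝒜 where
  n := a.n + b.n
  δ := Sum.elim a.δ b.δ ∘ finSumFinEquiv.symm
  p := (Matrix.fromBlocks a.p 0 0 b.p).submatrix finSumFinEquiv.symm finSumFinEquiv.symm
  degZero := fun _ _ => a.degZero.fromBlocks b.degZero _ _
  idem := by
    rw [Matrix.submatrix_mul_equiv, fromBlocks_idem a.idem b.idem]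

/-- The shift of all degrees by `c`, representing the shifted module `P(c)`. -/
def shift (c : ℤ) (a : GradedIdem 𝒜) : GradedIdem 𝒜 where
  n := a.n
  δ := fun i => a.δ i + c
  p := a.p
  degZero := fun i j => by rw [add_sub_add_right_eq_sub]; exact a.degZero i j
  idem := a.idem

/-- The image under a ring homomorphism respecting the gradings. -/
def map {S : Type*} [NonUnitalRing S] {ℬ : ℤ → AddSubgroup S} (f : R →ₙ+* S)
    (hf : ∀ n, ∀ a ∈ 𝒜 n, f a ∈ ℬ n) (a : GradedIdem 𝒜) : GradedIdem ℬ where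
  n := a.n
  δ := a.δ
  p := a.p.map f
  degZero := fun i j => hf _ _ (a.degZero i j)
  idem := by
    rw [← map_matrix_mul, a.idem]

theorem blocks_equiv_add (a b : GradedIdem 𝒜) :
    GradedEquiv 𝒜 (Sum.elim a.δ b.δ) (a.add b).δ (Matrix.fromBlocks a.p 0 0 b.p) (a.add b).p :=
  GradedEquiv.of_equiv finSumFinEquiv (a.degZero.fromBlocks b.degZero)
    (fromBlocks_idem a.idem b.idem)
    (fun i => congrArg (Sum.elim a.δ b.δ) (Equiv.symm_apply_apply _ i))
    (fun i j => congrArg₂ (Matrix.fromBlocks a.p 0 0 b.p) (Equiv.symm_apply_apply _ i)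
      (Equiv.symm_apply_apply _ j))

variable [SetLike.GradedMul 𝒜]

theorem rel_refl (a : GradedIdem 𝒜) : Rel a a := Setoid.refl a

theorem add_congr {a a' b b' : GradedIdem 𝒜} (h : Rel a a') (h' : Rel b b') :
    Rel (a.add b) (a'.add b') :=
  GradedEquiv.trans (add a b).idem (add a' b').idem (blocks_equiv_add a b).symm <|
    GradedEquiv.trans (fromBlocks_idem a.idem b.idem) (add a' b').idem
      (GradedEquiv.fromBlocks h h') (blocks_equiv_add a' b')

theorem add_comm' (a b : GradedIdem 𝒜) : Rel (a.add b) (b.add a) := by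
  refine GradedEquiv.trans (add a b).idem (add b a).idem (blocks_equiv_add a b).symm <|
    GradedEquiv.trans (fromBlocks_idem a.idem b.idem) (add b a).idem ?_ (blocks_equiv_add b a)
  refine GradedEquiv.of_equiv (Equiv.sumComm _ _) (a.degZero.fromBlocks b.degZero)
    (fromBlocks_idem a.idem b.idem) ?_ ?_
  · rintro (i | i) <;> rfl
  · rintro (i | i) (j | j) <;> rfl

theorem zero_add' (a : GradedIdem 𝒜) : Rel ((zero 𝒜).add a) a := by
  refine GradedEquiv.trans (add (zero 𝒜) a).idem a.idem (blocks_equiv_add (zero 𝒜) a).symm ?_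
  refine GradedEquiv.symm (GradedEquiv.of_equiv (Equiv.emptySum (Fin 0) (Fin a.n)).symm
    a.degZero a.idem ?_ ?_)
  · intro i; rfl
  · intro i j; rfl

theorem add_assoc' (a b c : GradedIdem 𝒜) : Rel ((a.add b).add c) (a.add (b.add c)) := by
  refine GradedEquiv.trans (add (add a b) c).idem (add a (add b c)).idem
    (blocks_equiv_add _ c).symm ?_
  refine GradedEquiv.trans (fromBlocks_idem (add a b).idem c.idem) (add a (add b c)).idem
    (GradedEquiv.fromBlocks (blocks_equiv_add a b).symm (rel_refl c)) ?_
  refine GradedEquiv.trans (fromBlocks_idem (fromBlocks_idem a.idem b.idem) c.idem)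
    (add a (add b c)).idem ?_ (blocks_equiv_add a (add b c))
  refine GradedEquiv.trans (fromBlocks_idem (fromBlocks_idem a.idem b.idem) c.idem)
    (fromBlocks_idem a.idem (add b c).idem) ?_
    (GradedEquiv.fromBlocks (rel_refl a) (blocks_equiv_add b c))
  refine GradedEquiv.of_equiv (Equiv.sumAssoc _ _ _)
    ((a.degZero.fromBlocks b.degZero).fromBlocks c.degZero)
    (fromBlocks_idem (fromBlocks_idem a.idem b.idem) c.idem) ?_ ?_
  · rintro ((i | i) | i) <;> rfl
  · rintro ((i | i) | i) ((j | j) | j) <;> rfl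

end GradedIdem

/-- `V^gr(R)`: graded equivalence classes of homogeneous idempotent matrices over the `ℤ`-graded,
not necessarily unital, ring `R`. -/
def Vgr {R : Type*} [NonUnitalRing R] (𝒜 : ℤ → AddSubgroup R) [SetLike.GradedMul 𝒜] : Type _ :=
  Quotient (GradedIdem.setoid 𝒜)

namespace Vgr

variable {R : Type*} [NonUnitalRing R] {𝒜 : ℤ → AddSubgroup R} [SetLike.GradedMul 𝒜]

/-- The class of a homogeneous idempotent. -/
def mk (a : GradedIdem 𝒜) : Vgr 𝒜 := Quotient.mk _ a

theorem mk_surjective : Function.Surjective (mk : GradedIdem 𝒜 → Vgr 𝒜) := Quotient.mk_surjective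

instance : Zero (Vgr 𝒜) := ⟨mk (GradedIdem.zero 𝒜)⟩

instance : Add (Vgr 𝒜) :=
  ⟨Quotient.map₂ GradedIdem.add fun _ _ h _ _ h' => GradedIdem.add_congr h h'⟩

theorem mk_add (a b : GradedIdem 𝒜) : mk (a.add b) = mk a + mk b := rfl

instance : AddCommMonoid (Vgr 𝒜) where
  add_assoc := by
    rintro ⟨a⟩ ⟨b⟩ ⟨c⟩
    exact Quotient.sound (GradedIdem.add_assoc' a b c)
  zero_add := by
    rintro ⟨a⟩
    exact Quotient.sound (GradedIdem.zero_add' a)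
  add_zero := by
    rintro ⟨a⟩
    exact Quotient.sound
      (Setoid.trans (GradedIdem.add_comm' a (GradedIdem.zero 𝒜)) (GradedIdem.zero_add' a))
  add_comm := by
    rintro ⟨a⟩ ⟨b⟩
    exact Quotient.sound (GradedIdem.add_comm' a b)
  nsmul := nsmulRec

/-- The action of `c : ℤ` on `V^gr(R)` by the shift `[P] ↦ [P(c)]`. -/
def shift (c : ℤ) : Vgr 𝒜 →+ Vgr 𝒜 where
  toFun := Quotient.map (GradedIdem.shift c) fun a b h => by
    obtain ⟨x, y, hx, hy, h⟩ := h
    exact ⟨x, y, fun i j => by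
      simpa [GradedIdem.shift] using hx i j, fun i j => by
      simpa [GradedIdem.shift] using hy i j, h⟩
  map_zero' := Quotient.sound <| GradedEquiv.of_equiv (Equiv.refl (Fin 0))
    (GradedIdem.shift c (GradedIdem.zero 𝒜)).degZero (GradedIdem.shift c (GradedIdem.zero 𝒜)).idem
    (fun i => i.elim0) (fun i => i.elim0)
  map_add' := by
    rintro ⟨a⟩ ⟨b⟩
    refine Quotient.sound <| GradedEquiv.of_equiv (Equiv.refl (Fin (a.n + b.n)))
      (GradedIdem.shift c (a.add b)).degZero (GradedIdem.shift c (a.add b)).idem (fun i => ?_)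
      (fun i j => rfl)
    change Sum.elim (fun i => a.δ i + c) (fun i => b.δ i + c) (finSumFinEquiv.symm i) =
      Sum.elim a.δ b.δ (finSumFinEquiv.symm i) + c
    rcases finSumFinEquiv.symm i with j | j <;> rfl

theorem shift_zero : shift (𝒜 := 𝒜) 0 = AddMonoidHom.id _ := by
  ext ⟨a⟩
  refine congrArg mk (?_ : a.shift 0 = a)
  simp [GradedIdem.shift]

theorem shift_add (c d : ℤ) : shift (𝒜 := 𝒜) (c + d) = (shift c).comp (shift d) := by
  ext ⟨a⟩
  refine congrArg mk (?_ : a.shift (c + d) = (a.shift d).shift c)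
  simp [GradedIdem.shift, add_assoc, add_comm c d]

/-- Functoriality of `V^gr` for ring homomorphisms respecting the gradings. -/
def map {S : Type*} [NonUnitalRing S] {ℬ : ℤ → AddSubgroup S} [SetLike.GradedMul ℬ] (f : R →ₙ+* S)
    (hf : ∀ n, ∀ a ∈ 𝒜 n, f a ∈ ℬ n) : Vgr 𝒜 →+ Vgr ℬ where
  toFun := Quotient.map (GradedIdem.map f hf) fun a b h => by
    obtain ⟨x, y, hx, hy, hxy, hyx⟩ := h
    refine ⟨x.map f, y.map f, fun i j => hf _ _ (hx i j), fun i j => hf _ _ (hy i j), ?_, ?_⟩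
    · exact (map_matrix_mul f x y).symm.trans (congrArg (fun m => m.map f) hxy)
    · exact (map_matrix_mul f y x).symm.trans (congrArg (fun m => m.map f) hyx)
  map_zero' := Quotient.sound <| GradedEquiv.of_equiv (Equiv.refl (Fin 0))
    (GradedIdem.map f hf (GradedIdem.zero 𝒜)).degZero
    (GradedIdem.map f hf (GradedIdem.zero 𝒜)).idem
    (fun i => i.elim0) (fun i => i.elim0)
  map_add' := by
    rintro ⟨a⟩ ⟨b⟩
    refine Quotient.sound <| GradedEquiv.of_equiv (Equiv.refl (Fin (a.n + b.n)))
      (GradedIdem.map f hf (a.add b)).degZero (GradedIdem.map f hf (a.add b)).idem (fun i => rfl)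
      (fun i j => ?_)
    change Matrix.fromBlocks (a.p.map f) 0 0 (b.p.map f) (finSumFinEquiv.symm i)
      (finSumFinEquiv.symm j) =
        f (Matrix.fromBlocks a.p 0 0 b.p (finSumFinEquiv.symm i) (finSumFinEquiv.symm j))
    rcases finSumFinEquiv.symm i with i | i <;> rcases finSumFinEquiv.symm j with j | j <;> simp

end Vgr

/-- The graded Grothendieck group `K_0^gr(R)`: the group completion of `V^gr(R)`. -/
def K0gr {R : Type*} [NonUnitalRing R] (𝒜 : ℤ → AddSubgroup R) [SetLike.GradedMul 𝒜] : Type _ :=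
  Algebra.GrothendieckAddGroup (Vgr 𝒜)

namespace K0gr

variable {R : Type*} [NonUnitalRing R] {𝒜 : ℤ → AddSubgroup R} [SetLike.GradedMul 𝒜]

instance : AddCommGroup (K0gr 𝒜) :=
  inferInstanceAs (AddCommGroup (Algebra.GrothendieckAddGroup (Vgr 𝒜)))

/-- The canonical homomorphism `V^gr(R) → K_0^gr(R)`. -/
def of : Vgr 𝒜 →+ K0gr 𝒜 := Algebra.GrothendieckAddGroup.of

/-- The universal property of the group completion. -/
def lift {A : Type*} [AddCommGroup A] : (Vgr 𝒜 →+ A) ≃ (K0gr 𝒜 →+ A) :=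
  Algebra.GrothendieckAddGroup.lift

theorem lift_of {A : Type*} [AddCommGroup A] (f : Vgr 𝒜 →+ A) (v : Vgr 𝒜) : lift f (of v) = f v :=
  DFunLike.congr_fun (lift.symm_apply_apply f) v

theorem hom_ext {A : Type*} [AddCommGroup A] {f g : K0gr 𝒜 →+ A} (h : ∀ v, f (of v) = g (of v)) :
    f = g :=
  lift.symm.injective (AddMonoidHom.ext h)

/-- The shift action of `ℤ` on `K_0^gr(R)`. -/
def shift : Multiplicative ℤ →* AddMonoid.End (K0gr 𝒜) where
  toFun c := lift (of.comp (Vgr.shift c.toAdd))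
  map_one' := hom_ext fun v => by
    rw [lift_of]
    change of (Vgr.shift 0 v) = of v
    rw [Vgr.shift_zero]; rfl
  map_mul' c d := hom_ext fun v => by
    rw [lift_of]
    change of (Vgr.shift (c.toAdd + d.toAdd) v) =
      lift (of.comp (Vgr.shift c.toAdd)) (lift (of.comp (Vgr.shift d.toAdd)) (of v))
    rw [lift_of, AddMonoidHom.comp_apply, lift_of, Vgr.shift_add]; rfl

/-- `K_0^gr(R)` as a `ℤ[x, x⁻¹]`-module: `xⁿ` acts as the shift by `n`. -/
instance : Module (LaurentPolynomial ℤ) (K0gr 𝒜) :=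
  Module.compHom (K0gr 𝒜)
    (AddMonoidAlgebra.lift ℤ (AddMonoid.End (K0gr 𝒜)) ℤ shift).toRingHom

theorem T_smul_of (n : ℤ) (v : Vgr 𝒜) :
    (LaurentPolynomial.T n : LaurentPolynomial ℤ) • of v = of (Vgr.shift n v) := by
  change (AddMonoidAlgebra.lift ℤ (AddMonoid.End (K0gr 𝒜)) ℤ shift (LaurentPolynomial.T n)) (of v) = _
  rw [LaurentPolynomial.T, AddMonoidAlgebra.lift_single, one_smul]
  exact lift_of _ v

variable (𝒜) in
/-- The positive cone of `K_0^gr(R)`: the image of `V^gr(R)`. -/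
def positiveCone : AddSubmonoid (K0gr 𝒜) := AddMonoidHom.mrange of

/-- The pre-order of `K_0^gr(R)` induced by the positive cone. -/
instance : Preorder (K0gr 𝒜) where
  le a b := b - a ∈ positiveCone 𝒜
  le_refl a := by rw [sub_self]; exact zero_mem _
  le_trans a b c h h' := by
    rw [← sub_add_sub_cancel c b a]
    exact add_mem h' h

theorem le_iff {a b : K0gr 𝒜} : a ≤ b ↔ b - a ∈ positiveCone 𝒜 := Iff.rfl

end K0gr

namespace GradedIdeal

variable {k : Type*} [Field k] {V E : Type*} {G : DirGraph V E}

/-- A graded ideal `I` as a (non-unital) ring. -/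
def toSubring (I : GradedIdeal k G) : NonUnitalSubring (LPA k G) :=
  NonUnitalSubring.ofClass I.ideal

/-- The grading `I_n = I ∩ L_k(G)_n` of a graded ideal. -/
def grading (I : GradedIdeal k G) (n : ℤ) : AddSubgroup I.toSubring :=
  (LPA.grading k G n).comap (NonUnitalSubringClass.subtype I.toSubring : I.toSubring →+ LPA k G)

instance (I : GradedIdeal k G) : SetLike.GradedMul I.grading where
  mul_mem := fun _ _ _ _ ha hb =>
    SetLike.GradedMul.mul_mem (A := LPA.grading k G) ha hb

/-- `V^gr(I)`, regarded inside `K_0^gr(L_k(G))`: the image of the monoid `V^gr(I)` of the ring `I`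
under the homomorphism `V^gr(I) → V^gr(L_k(G)) → K_0^gr(L_k(G))` induced by the inclusion of `I`. -/
def vgr (I : GradedIdeal k G) : Set (K0gr (LPA.grading k G)) :=
  Set.range fun v : Vgr I.grading =>
    K0gr.of (Vgr.map (NonUnitalSubringClass.subtype I.toSubring) (fun _ _ h => h) v)

end GradedIdeal

end

/-! Graded ideals can be recovered from the ordered module `K0gr`: they correspond to its order
ideals, the shift-invariant hereditary submonoids of the positive cone. The correspondence sends `I`
to `I.vgr` and an order ideal `S` to the ideal generated by the entries of the idempotents whose
classes lie in `S`. Since `φ` preserves the module structure and the cone in both directions, it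
permutes order ideals, and hence transports graded ideals (`orderIsoOrderIdeals`, `orderIdealIso`).
Three facts carry this.

Over a row-finite graph a graded ideal is generated by its vertices (`mem_vertexSums`): multiplying
a homogeneous element by edges and ghost edges shortens its monomials until only vertices remain,
and the Cuntz-Krieger relation v = ∑ e e* restores the element.

The class of an idempotent lies in `I.vgr` exactly when its entries lie in `I` (`of_mk_mem_vgr`).
Equality in `K0gr` only gives a ⊕ d ~ c ⊕ d with c over `I`, so that modulo `I` the idempotent a ⊕ d
is equivalent to its subidempotent 0 ⊕ d. Degree-zero matrices lie in finite-dimensional algebras,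
by row-finiteness again, and a rank count forces a = 0 modulo `I`. Full cancellation in `Vgr` is not
needed.

Conversely, an idempotent over the ideal generated by `S` factors through an idempotent with class
in `S`, hence is a direct summand of it, and heredity puts its class in `S` (`vgr_ofOrderIdeal`).

For the spectra, a vertex satisfies v = v v, so I ∩ J is contained in any graded ideal containing
all products of elements of I and J. Graded primes are therefore the proper meet-prime elements of
the lattice (`isPrime_iff`), a notion invariant under order isomorphism, and the open sets W(I)
correspond as well. -/

noncomputable section

/-! ## Generators and monomials of the Leavitt path algebra -/

namespace LPA

variable (k : Type*) [Field k] {V E : Type*} (G : DirGraph V E)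

/-- A vertex, as an element of the Leavitt path algebra. -/
def vtx (v : V) : LPA k G := mk k G (FreeLPA.gen k (.vertex v))

/-- An edge, as an element of the Leavitt path algebra. -/
def edg (e : E) : LPA k G := mk k G (FreeLPA.gen k (.edge e))

/-- A ghost edge, as an element of the Leavitt path algebra. -/
def gho (e : E) : LPA k G := mk k G (FreeLPA.gen k (.ghost e))

variable {k G}

theorem mk_eq_of_rel {a b : FreeLPA k V E} (h : LRel k G a b) : mk k G a = mk k G b :=
  Quotient.sound (RingConGen.Rel.of _ _ ⟨1, a, b, h, (one_smul _ _).symm, (one_smul _ _).symm⟩)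

theorem vtx_mul_vtx_self (v : V) : vtx k G v * vtx k G v = vtx k G v := by
  rw [vtx, ← map_mul]; exact mk_eq_of_rel (.vertex_self v)

theorem vtx_mul_vtx_ne {v w : V} (h : v ≠ w) : vtx k G v * vtx k G w = 0 := by
  rw [vtx, vtx, ← map_mul, mk_eq_of_rel (.vertex_ne v w h), map_zero]

theorem vtx_mul_edg (e : E) : vtx k G (G.s e) * edg k G e = edg k G e := by
  rw [vtx, edg, ← map_mul]; exact mk_eq_of_rel (.source_edge e)

theorem edg_mul_vtx (e : E) : edg k G e * vtx k G (G.r e) = edg k G e := by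
  rw [vtx, edg, ← map_mul]; exact mk_eq_of_rel (.edge_range e)

theorem vtx_mul_gho (e : E) : vtx k G (G.r e) * gho k G e = gho k G e := by
  rw [vtx, gho, ← map_mul]; exact mk_eq_of_rel (.range_ghost e)

theorem gho_mul_vtx (e : E) : gho k G e * vtx k G (G.s e) = gho k G e := by
  rw [vtx, gho, ← map_mul]; exact mk_eq_of_rel (.ghost_source e)

theorem gho_mul_edg_self (e : E) : gho k G e * edg k G e = vtx k G (G.r e) := by
  rw [gho, edg, ← map_mul]; exact mk_eq_of_rel (.ghost_edge_self e)

theorem gho_mul_edg_ne {e f : E} (h : e ≠ f) : gho k G e * edg k G f = 0 := by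
  rw [gho, edg, ← map_mul, mk_eq_of_rel (.ghost_edge_ne e f h), map_zero]

theorem vtx_eq_sum {v : V} (hfin : {e | G.s e = v}.Finite) (hne : {e | G.s e = v}.Nonempty) :
    vtx k G v = ∑ e ∈ hfin.toFinset, edg k G e * gho k G e := by
  rw [vtx, mk_eq_of_rel (.vertex_sum v hfin hne), map_sum]
  exact Finset.sum_congr rfl fun e _ => map_mul _ _ _

variable (k G)

/-- The paths of length `n` with source `v`, as elements of the Leavitt path algebra. -/
def pathsFrom : ℕ → V → Set (LPA k G)
  | 0, v => {vtx k G v}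
  | n + 1, v => {c | ∃ e, G.s e = v ∧ ∃ a ∈ pathsFrom n (G.r e), c = edg k G e * a}

/-- The ghosts of the paths of length `n` with source `v`. -/
def ghostsFrom : ℕ → V → Set (LPA k G)
  | 0, v => {vtx k G v}
  | n + 1, v => {c | ∃ e, G.s e = v ∧ ∃ b ∈ ghostsFrom n (G.r e), c = b * gho k G e}

variable {k G}

theorem finite_pathsFrom (hG : G.RowFinite) (n : ℕ) (v : V) : (pathsFrom k G n v).Finite := by
  induction n generalizing v with
  | zero => exact Set.finite_singleton _
  | succ n ih =>
    refine ((hG v).biUnion fun e _ => (ih (G.r e)).image (edg k G e * ·)).subset ?_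
    rintro c ⟨e, he, a, ha, rfl⟩
    exact Set.mem_biUnion he ⟨a, ha, rfl⟩

theorem finite_ghostsFrom (hG : G.RowFinite) (n : ℕ) (v : V) : (ghostsFrom k G n v).Finite := by
  induction n generalizing v with
  | zero => exact Set.finite_singleton _
  | succ n ih =>
    refine ((hG v).biUnion fun e _ => (ih (G.r e)).image (· * gho k G e)).subset ?_
    rintro c ⟨e, he, a, ha, rfl⟩
    exact Set.mem_biUnion he ⟨a, ha, rfl⟩

theorem vtx_mul_path {n : ℕ} {v : V} {a : LPA k G} (ha : a ∈ pathsFrom k G n v) :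
    vtx k G v * a = a := by
  cases n with
  | zero => obtain rfl := ha; exact vtx_mul_vtx_self v
  | succ n => obtain ⟨e, rfl, a, -, rfl⟩ := ha; rw [← mul_assoc, vtx_mul_edg]

theorem vtx_mul_path_ne {n : ℕ} {v w : V} {a : LPA k G} (ha : a ∈ pathsFrom k G n v)
    (h : w ≠ v) : vtx k G w * a = 0 := by
  rw [← vtx_mul_path ha, ← mul_assoc, vtx_mul_vtx_ne h, zero_mul]

theorem ghost_mul_vtx {n : ℕ} {v : V} {b : LPA k G} (hb : b ∈ ghostsFrom k G n v) :
    b * vtx k G v = b := by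
  cases n with
  | zero => obtain rfl := hb; exact vtx_mul_vtx_self v
  | succ n => obtain ⟨e, rfl, b, -, rfl⟩ := hb; rw [mul_assoc, gho_mul_vtx]

theorem ghost_mul_vtx_ne {n : ℕ} {v w : V} {b : LPA k G} (hb : b ∈ ghostsFrom k G n v)
    (h : v ≠ w) : b * vtx k G w = 0 := by
  rw [← ghost_mul_vtx hb, mul_assoc, vtx_mul_vtx_ne h, mul_zero]

theorem path_mul_path {n m : ℕ} {v w : V} {a b : LPA k G} (ha : a ∈ pathsFrom k G n v)
    (hb : b ∈ pathsFrom k G m w) : a * b = 0 ∨ a * b ∈ pathsFrom k G (n + m) v := by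
  induction n generalizing v a with
  | zero =>
    obtain rfl := ha
    by_cases h : v = w
    · subst h; rw [vtx_mul_path hb, zero_add]; exact .inr hb
    · exact .inl (vtx_mul_path_ne hb h)
  | succ n ih =>
    obtain ⟨e, rfl, a, ha, rfl⟩ := ha
    rw [mul_assoc, add_right_comm]
    rcases ih ha with h | h
    · rw [h, mul_zero]; exact .inl rfl
    · exact .inr ⟨e, rfl, _, h, rfl⟩

theorem ghost_mul_ghost {n m : ℕ} {v w : V} {a b : LPA k G} (ha : a ∈ ghostsFrom k G n v)
    (hb : b ∈ ghostsFrom k G m w) : a * b = 0 ∨ a * b ∈ ghostsFrom k G (n + m) w := by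
  induction m generalizing w b with
  | zero =>
    obtain rfl := hb
    by_cases h : v = w
    · subst h; rw [ghost_mul_vtx ha]; exact .inr ha
    · exact .inl (ghost_mul_vtx_ne ha h)
  | succ m ih =>
    obtain ⟨e, rfl, b, hb, rfl⟩ := hb
    rw [← mul_assoc]
    rcases ih hb with h | h
    · rw [h, zero_mul]; exact .inl rfl
    · exact .inr ⟨e, rfl, _, h, rfl⟩

theorem edg_mem_pathsFrom (e : E) : edg k G e ∈ pathsFrom k G 1 (G.s e) :=
  ⟨e, rfl, _, rfl, (edg_mul_vtx e).symm⟩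

theorem gho_mem_ghostsFrom (e : E) : gho k G e ∈ ghostsFrom k G 1 (G.s e) :=
  ⟨e, rfl, _, rfl, (vtx_mul_gho e).symm⟩

theorem gho_mul_path {n : ℕ} {v : V} {a : LPA k G} (e : E) (ha : a ∈ pathsFrom k G (n + 1) v) :
    gho k G e * a = 0 ∨ gho k G e * a ∈ pathsFrom k G n (G.r e) := by
  obtain ⟨f, rfl, a, ha, rfl⟩ := ha
  rw [← mul_assoc]
  by_cases h : e = f
  · subst h; rw [gho_mul_edg_self, vtx_mul_path ha]; exact .inr ha
  · rw [gho_mul_edg_ne h, zero_mul]; exact .inl rfl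

/-- In β*α the first edges of β and α meet and cancel by e*e = r(e), or kill the product. What
survives is the tail of the longer path; `d` is its length. -/
theorem ghost_mul_path {n m : ℕ} {v w : V} {a b : LPA k G} (hb : b ∈ ghostsFrom k G m w)
    (ha : a ∈ pathsFrom k G n v) :
    b * a = 0 ∨ (∃ d u, n = m + d ∧ b * a ∈ pathsFrom k G d u) ∨
      ∃ d u, m = n + d ∧ b * a ∈ ghostsFrom k G d u := by
  induction m generalizing w b n v a with
  | zero =>
    obtain rfl := hb
    by_cases h : w = v
    · subst h; rw [vtx_mul_path ha]; exact .inr (.inl ⟨n, w, (zero_add n).symm, ha⟩)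
    · exact .inl (vtx_mul_path_ne ha h)
  | succ m ih =>
    cases n with
    | zero =>
      obtain rfl := ha
      by_cases h : w = v
      · subst h; rw [ghost_mul_vtx hb]; exact .inr (.inr ⟨m + 1, w, (zero_add _).symm, hb⟩)
      · exact .inl (ghost_mul_vtx_ne hb h)
    | succ n =>
      obtain ⟨e, rfl, b, hb, rfl⟩ := hb
      rw [mul_assoc]
      rcases gho_mul_path e ha with h | h
      · rw [h, mul_zero]; exact .inl rfl
      · rcases ih hb h with h | ⟨d, u, hd, h⟩ | ⟨d, u, hd, h⟩
        · exact .inl h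
        · exact .inr (.inl ⟨d, u, by omega, h⟩)
        · exact .inr (.inr ⟨d, u, by omega, h⟩)

variable (k G)

/-- The monomials `α β*` where `α` has source `v` and length `p`, and `β` has source `w` and
length `q`. -/
def monomials (p q : ℕ) (v w : V) : Set (LPA k G) :=
  {c | ∃ a ∈ pathsFrom k G p v, ∃ b ∈ ghostsFrom k G q w, c = a * b}

variable {k G}

theorem finite_monomials (hG : G.RowFinite) (p q : ℕ) (v w : V) :
    (monomials k G p q v w).Finite := by
  refine ((finite_pathsFrom hG p v).image2 (· * ·) (finite_ghostsFrom hG q w)).subset ?_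
  rintro c ⟨a, ha, b, hb, rfl⟩
  exact ⟨a, ha, b, hb, rfl⟩

theorem vtx_mul_monomial {p q : ℕ} {v w : V} {c : LPA k G} (hc : c ∈ monomials k G p q v w) :
    vtx k G v * c = c := by
  obtain ⟨a, ha, b, -, rfl⟩ := hc
  rw [← mul_assoc, vtx_mul_path ha]

theorem vtx_mul_monomial_ne {p q : ℕ} {u v w : V} {c : LPA k G}
    (hc : c ∈ monomials k G p q v w) (h : u ≠ v) : vtx k G u * c = 0 := by
  obtain ⟨a, ha, b, -, rfl⟩ := hc
  rw [← mul_assoc, vtx_mul_path_ne ha h, zero_mul]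

theorem monomial_mul_vtx {p q : ℕ} {v w : V} {c : LPA k G} (hc : c ∈ monomials k G p q v w) :
    c * vtx k G w = c := by
  obtain ⟨a, -, b, hb, rfl⟩ := hc
  rw [mul_assoc, ghost_mul_vtx hb]

theorem monomial_mul_vtx_ne {p q : ℕ} {u v w : V} {c : LPA k G}
    (hc : c ∈ monomials k G p q v w) (h : w ≠ u) : c * vtx k G u = 0 := by
  obtain ⟨a, -, b, hb, rfl⟩ := hc
  rw [mul_assoc, ghost_mul_vtx_ne hb h, mul_zero]

/-- The inner product β*α' collapses to zero, to a path that extends α, or to a ghost that extends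
β'*. The exact lengths are kept because the later filtrations count them. -/
theorem monomial_mul_monomial {p q p' q' : ℕ} {v w v' w' : V} {c c' : LPA k G}
    (hc : c ∈ monomials k G p q v w) (hc' : c' ∈ monomials k G p' q' v' w') :
    c * c' = 0 ∨ (∃ d, p' = q + d ∧ c * c' ∈ monomials k G (p + d) q' v w') ∨
      ∃ d, q = p' + d ∧ c * c' ∈ monomials k G p (d + q') v w' := by
  obtain ⟨a, ha, b, hb, rfl⟩ := hc
  obtain ⟨a', ha', b', hb', rfl⟩ := hc'
  have hm : a * b * (a' * b') = a * (b * a') * b' := by simp only [mul_assoc]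
  rw [hm]
  rcases ghost_mul_path hb ha' with h | ⟨d, u, hd, h⟩ | ⟨d, u, hd, h⟩
  · rw [h, mul_zero, zero_mul]; exact .inl rfl
  · rcases path_mul_path ha h with h | h
    · rw [h, zero_mul]; exact .inl rfl
    · exact .inr (.inl ⟨d, hd, _, h, _, hb', rfl⟩)
  · rw [mul_assoc]
    rcases ghost_mul_ghost h hb' with h | h
    · rw [h, mul_zero]; exact .inl rfl
    · exact .inr (.inr ⟨d, hd, _, ha, _, h, rfl⟩)

theorem vtx_mem_monomials (v : V) : vtx k G v ∈ monomials k G 0 0 v v :=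
  ⟨_, rfl, _, rfl, (vtx_mul_vtx_self v).symm⟩

theorem edg_mem_monomials (e : E) : edg k G e ∈ monomials k G 1 0 (G.s e) (G.r e) :=
  ⟨_, edg_mem_pathsFrom e, _, rfl, (edg_mul_vtx e).symm⟩

theorem gho_mem_monomials (e : E) : gho k G e ∈ monomials k G 0 1 (G.r e) (G.s e) :=
  ⟨_, rfl, _, gho_mem_ghostsFrom e, (vtx_mul_gho e).symm⟩

theorem word_eq_zero_or_mem_monomials (w : FreeSemigroup (LGen V E)) :
    mk k G (FreeLPA.word k w) = 0 ∨ ∃ (p q : ℕ) (u v : V), (p : ℤ) - q = FreeLPA.wordDegree w ∧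
      mk k G (FreeLPA.word k w) ∈ monomials k G p q u v := by
  induction w using FreeSemigroup.recOnMul with
  | ih1 x =>
    refine .inr ?_
    cases x with
    | vertex v => exact ⟨0, 0, v, v, rfl, vtx_mem_monomials v⟩
    | edge e => exact ⟨1, 0, _, _, rfl, edg_mem_monomials e⟩
    | ghost e => exact ⟨0, 1, _, _, rfl, gho_mem_monomials e⟩
  | ih2 x w hx hw =>
    have h1 : mk k G (FreeLPA.word k (FreeSemigroup.of x * w)) =
        mk k G (FreeLPA.word k (FreeSemigroup.of x)) * mk k G (FreeLPA.word k w) := by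
      rw [← map_mul]; simp [FreeLPA.word]
    have h2 : FreeLPA.wordDegree (FreeSemigroup.of x * w) =
        FreeLPA.wordDegree (FreeSemigroup.of x) + FreeLPA.wordDegree w := by
      simp [FreeLPA.wordDegree, map_mul]
    rw [h1, h2]
    rcases hx with hx | ⟨p, q, u, v, hd, hx⟩
    · rw [hx, zero_mul]; exact .inl rfl
    rcases hw with hw | ⟨p', q', u', v', hd', hw⟩
    · rw [hw, mul_zero]; exact .inl rfl
    rcases monomial_mul_monomial hx hw with h | ⟨d, e, h⟩ | ⟨d, e, h⟩
    · exact .inl h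
    · exact .inr ⟨_, _, _, _, by push_cast; omega, h⟩
    · exact .inr ⟨_, _, _, _, by push_cast; omega, h⟩

/-- A homogeneous element is a linear combination of monomials of the same degree. -/
theorem grading_induction {n : ℤ} {motive : LPA k G → Prop} (zero : motive 0)
    (add : ∀ a b, motive a → motive b → motive (a + b))
    (smul_monomial : ∀ (c : k) (p q : ℕ) (v w : V), (p : ℤ) - q = n →
      ∀ a ∈ monomials k G p q v w, motive (c • a))
    {a : LPA k G} (ha : a ∈ grading k G n) : motive a := by
  rw [grading, Submodule.mem_toAddSubgroup] at ha
  refine Submodule.closure_induction (p := fun a _ => motive a) zero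
    (fun _ _ _ _ => add _ _) ?_ ha
  rintro c _ ⟨w, rfl, rfl⟩
  rcases word_eq_zero_or_mem_monomials (k := k) (G := G) w with h | ⟨p, q, u, v, hd, h⟩
  · rw [h, smul_zero]; exact zero
  · exact smul_monomial c p q u v hd _ h

end LPA

/-! ## Graded ideals are generated by vertices -/

namespace LPA

open Filter

variable {k : Type*} [Field k] {V E : Type*} {G : DirGraph V E}

theorem monomial_induction {motive : LPA k G → Prop} (zero : motive 0)
    (add : ∀ a b, motive a → motive b → motive (a + b))
    (smul_monomial : ∀ (c : k) (p q : ℕ) (v w : V),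
      ∀ a ∈ monomials k G p q v w, motive (c • a))
    (a : LPA k G) : motive a := by
  obtain ⟨a, rfl⟩ := mk_surjective k G a
  induction a using MonoidAlgebra.induction_linear with
  | zero => rw [map_zero]; exact zero
  | add x y hx hy => rw [map_add]; exact add _ _ hx hy
  | single w c =>
    have : (MonoidAlgebra.single w c : FreeLPA k V E) = c • FreeLPA.word k w := by
      simp [FreeLPA.word]
    rw [this, mk_smul]
    rcases word_eq_zero_or_mem_monomials (k := k) (G := G) w with h | ⟨p, q, u, v, -, h⟩
    · rw [h, smul_zero]; exact zero
    · exact smul_monomial c p q u v _ h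

/-- Finite sums of vertices are local units: only the vertex at the source of a monomial acts on it
nontrivially from the left. Phrasing this along `atTop` makes the statement additive in `a`. -/
theorem eventually_sum_vtx_mul (a : LPA k G) :
    ∀ᶠ X : Finset V in atTop, (∑ v ∈ X, vtx k G v) * a = a := by
  induction a using monomial_induction with
  | zero => exact .of_forall fun _ => mul_zero _
  | add a b ha hb => filter_upwards [ha, hb] with X hX hY; rw [mul_add, hX, hY]
  | smul_monomial c p q v w a ha =>
    filter_upwards [eventually_ge_atTop {v}] with X hX
    rw [mul_smul_comm, Finset.sum_mul, Finset.sum_eq_single v, vtx_mul_monomial ha]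
    · exact fun u _ hu => vtx_mul_monomial_ne ha hu
    · exact fun h => absurd (Finset.singleton_subset_iff.1 hX) h

theorem eventually_mul_sum_vtx (a : LPA k G) :
    ∀ᶠ X : Finset V in atTop, a * ∑ v ∈ X, vtx k G v = a := by
  induction a using monomial_induction with
  | zero => exact .of_forall fun _ => zero_mul _
  | add a b ha hb => filter_upwards [ha, hb] with X hX hY; rw [add_mul, hX, hY]
  | smul_monomial c p q v w a ha =>
    filter_upwards [eventually_ge_atTop {w}] with X hX
    rw [smul_mul_assoc, Finset.mul_sum, Finset.sum_eq_single w, monomial_mul_vtx ha]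
    · exact fun u _ hu => monomial_mul_vtx_ne ha hu.symm
    · exact fun h => absurd (Finset.singleton_subset_iff.1 hX) h

/-- Ring ideals are closed under scalars despite the missing unit, because a local unit ε gives c a
= (c ε) a. -/
theorem smul_mem_ideal (I : TwoSidedIdeal (LPA k G)) (c : k) {a : LPA k G} (ha : a ∈ I) :
    c • a ∈ I := by
  obtain ⟨X, hX⟩ := (eventually_sum_vtx_mul a).exists
  rw [← hX, ← smul_mul_assoc]
  exact I.mul_mem_left _ _ ha

/-- The sums of elements `u v w` where `v` is a vertex lying in the ideal `I`. -/
def vertexSums (I : TwoSidedIdeal (LPA k G)) : AddSubgroup (LPA k G) :=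
  AddSubgroup.closure {c | ∃ v u w, vtx k G v ∈ I ∧ c = u * vtx k G v * w}

theorem mul_mem_vertexSums_left {I : TwoSidedIdeal (LPA k G)} (x : LPA k G) {a : LPA k G}
    (ha : a ∈ vertexSums I) : x * a ∈ vertexSums I := by
  induction ha using AddSubgroup.closure_induction with
  | zero => rw [mul_zero]; exact zero_mem _
  | add y z _ _ hy hz => rw [mul_add]; exact add_mem hy hz
  | neg y _ hy => rw [mul_neg]; exact neg_mem hy
  | mem y hy =>
    obtain ⟨v, u, w, hv, rfl⟩ := hy
    exact AddSubgroup.subset_closure ⟨v, x * u, w, hv, by simp only [mul_assoc]⟩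

theorem mul_mem_vertexSums_right {I : TwoSidedIdeal (LPA k G)} (x : LPA k G) {a : LPA k G}
    (ha : a ∈ vertexSums I) : a * x ∈ vertexSums I := by
  induction ha using AddSubgroup.closure_induction with
  | zero => rw [zero_mul]; exact zero_mem _
  | add y z _ _ hy hz => rw [add_mul]; exact add_mem hy hz
  | neg y _ hy => rw [neg_mul]; exact neg_mem hy
  | mem y hy =>
    obtain ⟨v, u, w, hv, rfl⟩ := hy
    exact AddSubgroup.subset_closure ⟨v, u, w * x, hv, by simp only [mul_assoc]⟩

variable (k G) in
/-- The span of the monomials `α β*` of degree `p - q` with `|α| ≤ p` and `|β| ≤ q`. -/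
def monomialSpan (p q : ℕ) : Submodule k (LPA k G) :=
  Submodule.span k {c | ∃ p' q' v w, p' ≤ p ∧ q' ≤ q ∧ p' + q = q' + p ∧
    c ∈ monomials k G p' q' v w}

/-- Raising both bounds equally keeps the degree, so two elements of one degree can be placed in a
common span. -/
theorem monomialSpan_le_add (p q d : ℕ) : monomialSpan k G p q ≤ monomialSpan k G (p + d) (q + d) := by
  refine Submodule.span_mono ?_
  rintro c ⟨p', q', v, w, hp, hq, hd, hc⟩
  exact ⟨p', q', v, w, by omega, by omega, by omega, hc⟩

theorem exists_mem_monomialSpan {n : ℤ} {a : LPA k G} (ha : a ∈ grading k G n) :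
    ∃ p q : ℕ, (p : ℤ) - q = n ∧ a ∈ monomialSpan k G p q := by
  refine grading_induction (motive := fun a => ∃ p q : ℕ, (p : ℤ) - q = n ∧
    a ∈ monomialSpan k G p q) ?_ ?_ ?_ ha
  · exact ⟨n.toNat, (-n).toNat, by omega, zero_mem _⟩
  · rintro a b ⟨p, q, hd, ha⟩ ⟨p', q', hd', hb⟩
    refine ⟨p + p', q + p', by push_cast; omega, add_mem (monomialSpan_le_add _ _ _ ha) ?_⟩
    rw [show p + p' = p' + p by omega, show q + p' = q' + p by omega]
    exact monomialSpan_le_add _ _ _ hb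
  · intro c p q v w hd a ha
    exact ⟨p, q, hd, Submodule.smul_mem _ _
      (Submodule.subset_span ⟨p, q, v, w, le_rfl, le_rfl, by omega, ha⟩)⟩

theorem map_mem_of_monomials {p q : ℕ} {f : LPA k G →ₗ[k] LPA k G} {T : Submodule k (LPA k G)}
    (h : ∀ p' q' v w, p' ≤ p → q' ≤ q → p' + q = q' + p →
      ∀ c ∈ monomials k G p' q' v w, f c ∈ T)
    {b : LPA k G} (hb : b ∈ monomialSpan k G p q) : f b ∈ T := by
  have : monomialSpan k G p q ≤ T.comap f := by
    refine Submodule.span_le.2 ?_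
    rintro c ⟨p', q', v, w, hp, hq, hd, hc⟩
    exact h p' q' v w hp hq hd c hc
  exact this hb

/-- A ghost edge removes the first edge of α. If α has length 0, the ghost part grows by one
instead, but then the degree condition gives q' + p + 1 = q, which leaves room for it. -/
theorem gho_mul_mem_monomialSpan {p q : ℕ} {b : LPA k G} (hb : b ∈ monomialSpan k G (p + 1) q)
    (e : E) : gho k G e * b ∈ monomialSpan k G p q := by
  refine map_mem_of_monomials (f := LinearMap.mulLeft k (gho k G e)) ?_ hb
  intro p' q' v w hp hq hd c hc
  rw [LinearMap.mulLeft_apply]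
  rcases monomial_mul_monomial (gho_mem_monomials e) hc with h | ⟨d, hd', h⟩ | ⟨d, hd', h⟩
  · rw [h]; exact zero_mem _
  · exact Submodule.subset_span ⟨_, _, _, _, by omega, by omega, by omega, h⟩
  · exact Submodule.subset_span ⟨_, _, _, _, by omega, by omega, by omega, h⟩

theorem mul_edg_mem_monomialSpan {q : ℕ} {b : LPA k G} (hb : b ∈ monomialSpan k G 0 (q + 1))
    (e : E) : b * edg k G e ∈ monomialSpan k G 0 q := by
  refine map_mem_of_monomials (f := LinearMap.mulRight k (edg k G e)) ?_ hb
  intro p' q' v w hp hq hd c hc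
  rw [LinearMap.mulRight_apply]
  rcases monomial_mul_monomial hc (edg_mem_monomials e) with h | ⟨d, hd', h⟩ | ⟨d, hd', h⟩
  · rw [h]; exact zero_mem _
  · exact Submodule.subset_span ⟨_, _, _, _, by omega, by omega, by omega, h⟩
  · exact Submodule.subset_span ⟨_, _, _, _, by omega, by omega, by omega, h⟩

/-- No path of positive length starts at a sink, so only monomials with p' = 0 survive, and the
degree fixes q' = q - p. The truncated subtraction is harmless: for q < p nothing survives. -/
theorem sink_mul_mem_monomialSpan {p q : ℕ} {b : LPA k G} (hb : b ∈ monomialSpan k G p q) {u : V}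
    (hu : ∀ e, G.s e ≠ u) : vtx k G u * b ∈ monomialSpan k G 0 (q - p) := by
  refine map_mem_of_monomials (f := LinearMap.mulLeft k (vtx k G u)) ?_ hb
  intro p' q' v w hp hq hd c hc
  rw [LinearMap.mulLeft_apply]
  by_cases h : u = v
  · subst h
    rw [vtx_mul_monomial hc]
    cases p' with
    | zero => exact Submodule.subset_span ⟨_, _, _, _, by omega, by omega, by omega, hc⟩
    | succ p' =>
      obtain ⟨_, ⟨e, he, _⟩, _⟩ := hc
      exact absurd he (hu e)
  · rw [vtx_mul_monomial_ne hc h]; exact zero_mem _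

theorem mul_sink_eq_zero {q : ℕ} {b : LPA k G} (hb : b ∈ monomialSpan k G 0 (q + 1)) {u : V}
    (hu : ∀ e, G.s e ≠ u) : b * vtx k G u = 0 := by
  have := map_mem_of_monomials (f := LinearMap.mulRight k (vtx k G u)) (T := ⊥) ?_ hb
  · simpa using this
  intro p' q' v w hp hq hd c hc
  rw [LinearMap.mulRight_apply]
  by_cases h : w = u
  · subst h
    cases q' with
    | zero => omega
    | succ q' =>
      obtain ⟨_, _, _, ⟨e, he, _⟩, _⟩ := hc
      exact absurd he (hu e)
  · rw [monomial_mul_vtx_ne hc h]; exact zero_mem _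

theorem vtx_mul_mul_vtx_mem_span {b : LPA k G} (hb : b ∈ monomialSpan k G 0 0) (v w : V) :
    vtx k G v * b * vtx k G w ∈ Submodule.span k {vtx k G v} := by
  refine map_mem_of_monomials
    (f := (LinearMap.mulRight k (vtx k G w)).comp (LinearMap.mulLeft k (vtx k G v))) ?_ hb
  intro p' q' u u' hp hq hd c hc
  rw [LinearMap.comp_apply, LinearMap.mulRight_apply, LinearMap.mulLeft_apply]
  obtain rfl : p' = 0 := by omega
  obtain rfl : q' = 0 := by omega
  obtain ⟨_, rfl, _, rfl, rfl⟩ := hc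
  by_cases h : v = u
  swap
  · rw [← mul_assoc, vtx_mul_vtx_ne h, zero_mul, zero_mul]; exact zero_mem _
  by_cases h' : u = u'
  swap
  · rw [vtx_mul_vtx_ne h', mul_zero, zero_mul]; exact zero_mem _
  by_cases h'' : u' = w
  swap
  · rw [mul_assoc, mul_assoc, vtx_mul_vtx_ne h'', mul_zero, mul_zero]; exact zero_mem _
  subst h h' h''
  simp only [vtx_mul_vtx_self]
  exact Submodule.mem_span_singleton_self _

/-- Induction on a bound for p + q. The paths are shortened from the left while p > 0, then the
ghosts from the right; multiplying back by edges or ghost edges stays inside `vertexSums`. At p = q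
= 0 the element is a combination of vertices. -/
theorem mem_vertexSums_of_mem_monomialSpan (hG : G.RowFinite) (I : TwoSidedIdeal (LPA k G))
    (N : ℕ) : ∀ (p q : ℕ), p + q ≤ N → ∀ b ∈ monomialSpan k G p q, b ∈ I → b ∈ vertexSums I := by
  induction N with
  | zero =>
    intro p q hN b hb hbI
    obtain rfl : p = 0 := by omega
    obtain rfl : q = 0 := by omega
    obtain ⟨X, hX⟩ := (eventually_sum_vtx_mul b).exists
    obtain ⟨Y, hY⟩ := (eventually_mul_sum_vtx b).exists
    rw [← hX, ← hY, ← mul_assoc, Finset.mul_sum, Finset.sum_mul, Finset.sum_congr rfl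
      fun w _ => Finset.sum_mul _ _ _]
    refine sum_mem fun w _ => sum_mem fun v _ => ?_
    -- Here v b w = c v lies in `I`; if c ≠ 0, dividing by c puts the vertex v itself in `I`.
    obtain ⟨c, hc⟩ := Submodule.mem_span_singleton.1 (vtx_mul_mul_vtx_mem_span hb v w)
    rw [← hc]
    by_cases h0 : c = 0
    · rw [h0, zero_smul]; exact zero_mem _
    refine AddSubgroup.subset_closure ⟨v, c • vtx k G v, vtx k G v, ?_, ?_⟩
    · rw [← inv_smul_smul₀ h0 (vtx k G v), hc]
      exact smul_mem_ideal _ _ (I.mul_mem_right _ _ (I.mul_mem_left _ _ hbI))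
    · rw [smul_mul_assoc, smul_mul_assoc, vtx_mul_vtx_self, vtx_mul_vtx_self]
  | succ N ih =>
    intro p q hN b hb hbI
    by_cases hlt : p + q ≤ N
    · exact ih p q hlt b hb hbI
    cases p with
    | succ p =>
      obtain ⟨X, hX⟩ := (eventually_sum_vtx_mul b).exists
      rw [← hX, Finset.sum_mul]
      refine sum_mem fun v _ => ?_
      by_cases hv : {e | G.s e = v}.Nonempty
      -- v b = ∑ e (e* b), where each e* b is still in `I` and falls under the induction hypothesis.
      -- Sinks have no such expansion and are treated separately.
      · rw [vtx_eq_sum (hG v) hv, Finset.sum_mul]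
        refine sum_mem fun e _ => ?_
        rw [mul_assoc]
        exact mul_mem_vertexSums_left _
          (ih p q (by omega) _ (gho_mul_mem_monomialSpan hb e) (I.mul_mem_left _ _ hbI))
      · exact ih 0 (q - (p + 1)) (by omega) _
          (sink_mul_mem_monomialSpan hb fun e he => hv ⟨e, he⟩) (I.mul_mem_left _ _ hbI)
    | zero =>
      obtain ⟨q, rfl⟩ : ∃ q', q = q' + 1 := ⟨q - 1, by omega⟩
      obtain ⟨X, hX⟩ := (eventually_mul_sum_vtx b).exists
      rw [← hX, Finset.mul_sum]
      refine sum_mem fun v _ => ?_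
      by_cases hv : {e | G.s e = v}.Nonempty
      · rw [vtx_eq_sum (hG v) hv, Finset.mul_sum]
        refine sum_mem fun e _ => ?_
        rw [← mul_assoc]
        exact mul_mem_vertexSums_right _
          (ih 0 q (by omega) _ (mul_edg_mem_monomialSpan hb e) (I.mul_mem_right _ _ hbI))
      · rw [mul_sink_eq_zero hb fun e he => hv ⟨e, he⟩]; exact zero_mem _

/-- Over a row-finite graph, a graded ideal is generated by the vertices it contains. -/
theorem mem_vertexSums (hG : G.RowFinite) (I : GradedIdeal k G) {a : LPA k G} (ha : a ∈ I.ideal) :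
    a ∈ vertexSums I.ideal := by
  refine (AddSubgroup.closure_le _).2 ?_ (I.2 a ha)
  rintro b ⟨hb, n, hn⟩
  obtain ⟨p, q, -, hpq⟩ := exists_mem_monomialSpan hn
  exact mem_vertexSums_of_mem_monomialSpan hG _ _ p q le_rfl b hpq hb

end LPA

/-! ## The homogeneous components -/

namespace FreeLPA

variable (k : Type*) [Field k] {V E : Type*}

theorem word_mul (w w' : FreeSemigroup (LGen V E)) : word k (w * w') = word k w * word k w' := by
  simp [word]

theorem wordDegree_mul (w w' : FreeSemigroup (LGen V E)) :
    wordDegree (w * w') = wordDegree w + wordDegree w' := by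
  simp [wordDegree, map_mul]

/-- The span of the words of degree `n`. -/
def homogeneous (n : ℤ) : Submodule k (FreeLPA k V E) :=
  Submodule.span k {a | ∃ w, wordDegree w = n ∧ a = word k w}

variable {k}

theorem wordDegree_of (x : LGen V E) : wordDegree (FreeSemigroup.of x) = x.degree := rfl

theorem gen_mem_homogeneous (x : LGen V E) {n : ℤ} (h : x.degree = n) :
    gen k x ∈ homogeneous k n :=
  Submodule.subset_span ⟨FreeSemigroup.of x, h, rfl⟩

theorem gen_mul_gen_mem_homogeneous (x y : LGen V E) {n : ℤ} (h : x.degree + y.degree = n) :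
    gen k x * gen k y ∈ homogeneous k n := by
  refine Submodule.subset_span ⟨FreeSemigroup.of x * FreeSemigroup.of y, ?_, ?_⟩
  · rw [wordDegree_mul, wordDegree_of, wordDegree_of, h]
  · rw [word_mul]; rfl

end FreeLPA

/-- Homogeneity of the relations is what makes the grading of the free algebra descend. A relation
with right-hand side 0 causes no difficulty, as 0 lies in every component. -/
theorem LRel.exists_mem_homogeneous {k : Type*} [Field k] {V E : Type*} {G : DirGraph V E}
    {a b : FreeLPA k V E} (h : LRel k G a b) :
    ∃ n, a ∈ FreeLPA.homogeneous k n ∧ b ∈ FreeLPA.homogeneous k n := by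
  open FreeLPA in
  cases h with
  | vertex_self _ =>
    exact ⟨0, gen_mul_gen_mem_homogeneous (.vertex _) (.vertex _) rfl, gen_mem_homogeneous (.vertex _) rfl⟩
  | vertex_ne _ _ _ =>
    exact ⟨0, gen_mul_gen_mem_homogeneous (.vertex _) (.vertex _) rfl, zero_mem _⟩
  | source_edge _ =>
    exact ⟨1, gen_mul_gen_mem_homogeneous (.vertex _) (.edge _) rfl, gen_mem_homogeneous (.edge _) rfl⟩
  | edge_range _ =>
    exact ⟨1, gen_mul_gen_mem_homogeneous (.edge _) (.vertex _) rfl, gen_mem_homogeneous (.edge _) rfl⟩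
  | range_ghost _ =>
    exact ⟨-1, gen_mul_gen_mem_homogeneous (.vertex _) (.ghost _) rfl, gen_mem_homogeneous (.ghost _) rfl⟩
  | ghost_source _ =>
    exact ⟨-1, gen_mul_gen_mem_homogeneous (.ghost _) (.vertex _) rfl, gen_mem_homogeneous (.ghost _) rfl⟩
  | ghost_edge_self _ =>
    exact ⟨0, gen_mul_gen_mem_homogeneous (.ghost _) (.edge _) rfl, gen_mem_homogeneous (.vertex _) rfl⟩
  | ghost_edge_ne _ _ _ =>
    exact ⟨0, gen_mul_gen_mem_homogeneous (.ghost _) (.edge _) rfl, zero_mem _⟩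
  | vertex_sum _ _ _ =>
    exact ⟨0, gen_mem_homogeneous (.vertex _) rfl, sum_mem fun _ _ => gen_mul_gen_mem_homogeneous (.edge _) (.ghost _) rfl⟩

namespace LPA

variable (k : Type*) [Field k] {V E : Type*} (G : DirGraph V E)

/-- The homomorphism from the free algebra to `L_k(G)[x, x⁻¹]` that records degrees. -/
def degreeHom : FreeLPA k V E →ₙₐ[k] AddMonoidAlgebra (Unitization k (LPA k G)) ℤ :=
  MonoidAlgebra.liftMagma k
    { toFun := fun w => AddMonoidAlgebra.single (FreeLPA.wordDegree w)
        (Unitization.inr (mk k G (FreeLPA.word k w)))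
      map_mul' := fun w w' => by
        rw [AddMonoidAlgebra.single_mul_single, FreeLPA.wordDegree_mul, FreeLPA.word_mul, map_mul,
          Unitization.inr_mul] }

variable {k G}

theorem degreeHom_of_mem {n : ℤ} {a : FreeLPA k V E} (ha : a ∈ FreeLPA.homogeneous k n) :
    degreeHom k G a = AddMonoidAlgebra.single n (Unitization.inr (mk k G a)) := by
  induction ha using Submodule.span_induction with
  | zero => simp
  | add a b _ _ ha hb =>
    rw [map_add, ha, hb, map_add, Unitization.inr_add, AddMonoidAlgebra.single_add]
  | smul c a _ ha =>
    rw [map_smul, ha, mk_smul, Unitization.inr_smul, AddMonoidAlgebra.smul_single]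
  | mem a ha =>
    obtain ⟨w, rfl, rfl⟩ := ha
    simp [degreeHom, FreeLPA.word]

/-- Both sides of a relation have one common degree n and the same class in the Leavitt path
algebra, so both go to the same monomial at xⁿ. Thus `degreeHom` factors through the quotient, and
its coefficients define the projections `proj`. -/
theorem degreeHom_eq {a b : FreeLPA k V E} (h : lpaCon k G a b) :
    degreeHom k G a = degreeHom k G b := by
  induction h with
  | of x y h =>
    obtain ⟨c, a, b, h, rfl, rfl⟩ := h
    obtain ⟨n, ha, hb⟩ := h.exists_mem_homogeneous
    rw [map_smul, map_smul, degreeHom_of_mem ha, degreeHom_of_mem hb, mk_eq_of_rel h]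
  | refl x => rfl
  | symm _ ih => exact ih.symm
  | trans _ _ ih₁ ih₂ => exact ih₁.trans ih₂
  | add _ _ ih₁ ih₂ => rw [map_add, map_add, ih₁, ih₂]
  | mul _ _ ih₁ ih₂ => rw [map_mul, map_mul, ih₁, ih₂]

variable (k G) in
/-- The projection of `L_k(G)` onto its component of degree `n`. -/
def proj (n : ℤ) : LPA k G →+ LPA k G where
  toFun := Quotient.lift (fun a => ((degreeHom k G a).coeff n).snd)
    fun _ _ h => congrArg (fun x => (x.coeff n).snd) (degreeHom_eq h)
  map_zero' := by
    change ((degreeHom k G 0).coeff n).snd = 0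
    rw [map_zero]; rfl
  map_add' a b := by
    obtain ⟨a, rfl⟩ := mk_surjective k G a
    obtain ⟨b, rfl⟩ := mk_surjective k G b
    change ((degreeHom k G (a + b)).coeff n).snd =
      ((degreeHom k G a).coeff n).snd + ((degreeHom k G b).coeff n).snd
    rw [map_add]; rfl

theorem exists_mk_of_mem_grading {n : ℤ} {a : LPA k G} (ha : a ∈ grading k G n) :
    ∃ b ∈ FreeLPA.homogeneous k n, mk k G b = a := by
  rw [grading, Submodule.mem_toAddSubgroup] at ha
  induction ha using Submodule.span_induction with
  | zero => exact ⟨0, zero_mem _, map_zero _⟩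
  | add a b _ _ ha hb =>
    obtain ⟨a, ha, rfl⟩ := ha
    obtain ⟨b, hb, rfl⟩ := hb
    exact ⟨a + b, add_mem ha hb, map_add _ _ _⟩
  | smul c a _ ha =>
    obtain ⟨a, ha, rfl⟩ := ha
    exact ⟨c • a, Submodule.smul_mem _ _ ha, mk_smul _ _ _ _⟩
  | mem a ha =>
    obtain ⟨w, rfl, rfl⟩ := ha
    exact ⟨_, Submodule.subset_span ⟨w, rfl, rfl⟩, rfl⟩

theorem proj_self {n : ℤ} {a : LPA k G} (ha : a ∈ grading k G n) : proj k G n a = a := by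
  obtain ⟨a, hb, rfl⟩ := exists_mk_of_mem_grading ha
  change ((degreeHom k G a).coeff n).snd = _
  rw [degreeHom_of_mem hb, AddMonoidAlgebra.coeff_single, Finsupp.single_eq_same]
  rfl

theorem proj_ne {m n : ℤ} (h : m ≠ n) {a : LPA k G} (ha : a ∈ grading k G m) :
    proj k G n a = 0 := by
  obtain ⟨a, hb, rfl⟩ := exists_mk_of_mem_grading ha
  change ((degreeHom k G a).coeff n).snd = _
  rw [degreeHom_of_mem hb, AddMonoidAlgebra.coeff_single, Finsupp.single_eq_of_ne h.symm]
  rfl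

/-- A homogeneous element that is a sum of homogeneous elements is the sum of those of the
same degree. -/
theorem mem_closure_of_mem_grading {S : Set (LPA k G)} (hS : ∀ a ∈ S, ∃ n, a ∈ grading k G n)
    {n : ℤ} {a : LPA k G} (ha : a ∈ AddSubgroup.closure S) (han : a ∈ grading k G n) :
    a ∈ AddSubgroup.closure {b | b ∈ S ∧ b ∈ grading k G n} := by
  rw [← proj_self han]
  have : AddSubgroup.closure S ≤
      (AddSubgroup.closure {b | b ∈ S ∧ b ∈ grading k G n}).comap (proj k G n) := by
    refine (AddSubgroup.closure_le _).2 fun b hb => ?_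
    obtain ⟨m, hm⟩ := hS b hb
    rw [AddSubgroup.coe_comap, Set.mem_preimage, SetLike.mem_coe]
    by_cases h : m = n
    · subst h; rw [proj_self hm]; exact AddSubgroup.subset_closure ⟨hb, hm⟩
    · rw [proj_ne h hm]; exact zero_mem _
  exact this ha

end LPA

/-! ## Stable finiteness -/

section LinearAlgebra

variable {k M : Type*} [Field k] [AddCommGroup M] [Module k M]

/-- In a finite-dimensional algebra of endomorphisms, an idempotent cannot be equivalent to a
proper subidempotent. -/
theorem LinearMap.comp_eq_of_equivalent_idempotents [FiniteDimensional k M] {X Y P Q : M →ₗ[k] M}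
    (hXY : X ∘ₗ Y = P) (hYX : Y ∘ₗ X = Q) (hP : P ∘ₗ P = P) (hPQ : P ∘ₗ Q = Q)
    (hQ : Q ∘ₗ Q = Q) : Q ∘ₗ P = P := by
  -- P = P² = X (Y X) Y = X Q Y gives rank P ≤ rank Q. Since the range of Q lies in that of P, the
  -- two ranges coincide.
  have h1 : P = X ∘ₗ (Q ∘ₗ Y) := by
    conv_lhs => rw [← hP, ← hXY]
    rw [← hYX]; rfl
  have h2 : LinearMap.range Q ≤ LinearMap.range P := by
    rw [← hPQ]; exact LinearMap.range_comp_le_range Q P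
  have h3 : Module.finrank k (LinearMap.range P) ≤ Module.finrank k (LinearMap.range Q) := by
    have e1 : LinearMap.range P = (LinearMap.range (Q ∘ₗ Y)).map X := by
      conv_lhs => rw [h1]
      exact LinearMap.range_comp _ _
    rw [e1]
    exact (Submodule.finrank_map_le X _).trans
      (Submodule.finrank_mono (LinearMap.range_comp_le_range Y Q))
  have h4 := Submodule.eq_of_le_of_finrank_le h2 h3
  ext v
  obtain ⟨u, hu⟩ : P v ∈ LinearMap.range Q := h4 ▸ LinearMap.mem_range_self P v
  rw [LinearMap.comp_apply, ← hu]
  exact LinearMap.congr_fun hQ u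

/-- All four maps descend to the finite-dimensional space D / (D ∩ J), where the congruences modulo
J become equalities and the rank count applies. -/
theorem LinearMap.sub_mem_of_equivalent_idempotents (D J : Submodule k M) [FiniteDimensional k D]
    {X Y P Q : M →ₗ[k] M}
    (hXD : ∀ v ∈ D, X v ∈ D) (hYD : ∀ v ∈ D, Y v ∈ D) (hPD : ∀ v ∈ D, P v ∈ D)
    (hQD : ∀ v ∈ D, Q v ∈ D) (hXJ : ∀ v ∈ J, X v ∈ J) (hYJ : ∀ v ∈ J, Y v ∈ J)
    (hPJ : ∀ v ∈ J, P v ∈ J) (hQJ : ∀ v ∈ J, Q v ∈ J)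
    (hXY : ∀ v ∈ D, X (Y v) - P v ∈ J) (hYX : ∀ v ∈ D, Y (X v) - Q v ∈ J)
    (hP : ∀ v, P (P v) = P v) (hPQ : ∀ v, P (Q v) = Q v) (hQ : ∀ v, Q (Q v) = Q v)
    {v : M} (hv : v ∈ D) : Q (P v) - P v ∈ J := by
  let J' : Submodule k D := J.comap D.subtype
  have hq : ∀ {a b : D}, (a : M) - b ∈ J → J'.mkQ a = J'.mkQ b := fun {a b} h =>
    (Submodule.Quotient.eq J').2 h
  let f (Z : M →ₗ[k] M) (hD : ∀ v ∈ D, Z v ∈ D) (hJ : ∀ v ∈ J, Z v ∈ J) : D ⧸ J' →ₗ[k] D ⧸ J' :=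
    J'.mapQ J' (Z.restrict hD) fun v hv => hJ _ hv
  have key := LinearMap.comp_eq_of_equivalent_idempotents
    (X := f X hXD hXJ) (Y := f Y hYD hYJ) (P := f P hPD hPJ) (Q := f Q hQD hQJ)
    (Submodule.linearMap_qext _ (LinearMap.ext fun v => hq (hXY v v.2)))
    (Submodule.linearMap_qext _ (LinearMap.ext fun v => hq (hYX v v.2)))
    (Submodule.linearMap_qext _ (LinearMap.ext fun v => congrArg J'.mkQ (Subtype.ext (hP v))))
    (Submodule.linearMap_qext _ (LinearMap.ext fun v => congrArg J'.mkQ (Subtype.ext (hPQ v))))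
    (Submodule.linearMap_qext _ (LinearMap.ext fun v => congrArg J'.mkQ (Subtype.ext (hQ v))))
  exact (Submodule.Quotient.eq J').1 (LinearMap.congr_fun key (J'.mkQ ⟨v, hv⟩))

end LinearAlgebra

section Matrix

variable {R ι κ τ μ ν : Type*} [NonUnitalNonAssocSemiring R] [Fintype κ]

theorem Matrix.fromCols_mul_fromRows_nonUnital [Fintype τ] (x₁ : Matrix ι κ R) (x₂ : Matrix ι τ R)
    (y₁ : Matrix κ μ R) (y₂ : Matrix τ μ R) :
    fromCols x₁ x₂ * fromRows y₁ y₂ = x₁ * y₁ + x₂ * y₂ := by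
  ext i j
  simp [Matrix.mul_apply]

theorem Matrix.fromRows_mul_fromCols_nonUnital (x₁ : Matrix ι κ R) (x₂ : Matrix τ κ R)
    (y₁ : Matrix κ μ R) (y₂ : Matrix κ ν R) :
    fromRows x₁ x₂ * fromCols y₁ y₂ = fromBlocks (x₁ * y₁) (x₁ * y₂) (x₂ * y₁) (x₂ * y₂) := by
  ext (i | i) (j | j) <;> simp [Matrix.mul_apply]

end Matrix

namespace LPA

open Filter

variable {k : Type*} [Field k] {V E : Type*} {G : DirGraph V E}
  {ι κ τ : Type*}

variable (k G) in
/-- The span of the monomials `α β*` of degree `n - m` with sources in `X` and `|α| + m ≤ N`. -/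
def levelSpan (X : Finset V) (N m n : ℤ) : Submodule k (LPA k G) :=
  Submodule.span k {c | ∃ v ∈ X, ∃ w ∈ X, ∃ p q : ℕ, p + m = q + n ∧ p + m ≤ N ∧
    c ∈ monomials k G p q v w}

theorem fg_levelSpan (hG : G.RowFinite) (X : Finset V) (N m n : ℤ) :
    (levelSpan k G X N m n).FG := by
  refine Submodule.fg_span ?_
  have : (⋃ v ∈ X, ⋃ w ∈ X, ⋃ p ∈ Finset.range ((N - m).toNat + 1),
      ⋃ q ∈ Finset.range ((N - n).toNat + 1), monomials k G p q v w).Finite :=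
    X.finite_toSet.biUnion fun v _ => X.finite_toSet.biUnion fun w _ =>
      (Finset.finite_toSet _).biUnion fun p _ => (Finset.finite_toSet _).biUnion fun q _ =>
        finite_monomials hG p q v w
  refine this.subset ?_
  rintro c ⟨v, hv, w, hw, p, q, h, hN, hc⟩
  simp only [Set.mem_iUnion, Finset.mem_range]
  exact ⟨v, hv, w, hw, p, by omega, q, by omega, hc⟩

/-- The bound is on the level |α| + m = |β| + n rather than on the lengths separately. Cancelling
β*α' produces a monomial whose level is the larger of the two levels, so a common bound N survives
multiplication. -/
theorem mul_mem_levelSpan {X : Finset V} {N l m n : ℤ} {a b : LPA k G}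
    (ha : a ∈ levelSpan k G X N l m) (hb : b ∈ levelSpan k G X N m n) :
    a * b ∈ levelSpan k G X N l n := by
  induction ha using Submodule.span_induction with
  | zero => rw [zero_mul]; exact zero_mem _
  | add x y _ _ hx hy => rw [add_mul]; exact add_mem hx hy
  | smul c x _ hx => rw [smul_mul_assoc]; exact Submodule.smul_mem _ _ hx
  | mem x hx =>
    induction hb using Submodule.span_induction with
    | zero => rw [mul_zero]; exact zero_mem _
    | add x y _ _ hx hy => rw [mul_add]; exact add_mem hx hy
    | smul c x _ hx => rw [mul_smul_comm]; exact Submodule.smul_mem _ _ hx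
    | mem y hy =>
      obtain ⟨v, hv, w, hw, p, q, h, hN, hc⟩ := hx
      obtain ⟨v', hv', w', hw', p', q', h', hN', hc'⟩ := hy
      rcases monomial_mul_monomial hc hc' with h0 | ⟨d, hd, h0⟩ | ⟨d, hd, h0⟩
      · rw [h0]; exact zero_mem _
      · exact Submodule.subset_span ⟨v, hv, w', hw', _, _, by push_cast; omega, by
          push_cast; omega, h0⟩
      · exact Submodule.subset_span ⟨v, hv, w', hw', _, _, by push_cast; omega, by omega, h0⟩

theorem eventually_mem_levelSpan {m n : ℤ} {a : LPA k G} (ha : a ∈ grading k G (n - m)) :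
    ∀ᶠ XN : Finset V × ℤ in atTop, a ∈ levelSpan k G XN.1 XN.2 m n := by
  classical
  refine grading_induction (motive := fun a => ∀ᶠ XN : Finset V × ℤ in atTop,
    a ∈ levelSpan k G XN.1 XN.2 m n) ?_ ?_ ?_ ha
  · exact .of_forall fun _ => zero_mem _
  · intro a b ha hb
    filter_upwards [ha, hb] with XN h h'
    exact add_mem h h'
  · intro c p q v w hd a ha
    filter_upwards [eventually_ge_atTop (({v, w} : Finset V), (p : ℤ) + m)] with XN h
    refine Submodule.smul_mem _ _ (Submodule.subset_span
      ⟨v, h.1 (by simp), w, h.1 (by simp), p, q, by omega, h.2, ha⟩)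

variable (k G) in
/-- The matrices whose entries lie in the spans `levelSpan`: a finite-dimensional algebra. -/
def levelMatrices (δ : ι → ℤ) (X : Finset V) (N : ℤ) : Submodule k (Matrix ι ι (LPA k G)) where
  carrier := {A | ∀ i j, A i j ∈ levelSpan k G X N (δ i) (δ j)}
  add_mem' hA hB i j := add_mem (hA i j) (hB i j)
  zero_mem' _ _ := zero_mem _
  smul_mem' c _ hA i j := Submodule.smul_mem _ c (hA i j)

theorem finiteDimensional_levelMatrices [Fintype ι] (hG : G.RowFinite) (δ : ι → ℤ) (X : Finset V) (N : ℤ) :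
    FiniteDimensional k (levelMatrices k G δ X N) := by
  have h (i j : ι) : FiniteDimensional k (levelSpan k G X N (δ i) (δ j)) :=
    Module.Finite.of_fg (fg_levelSpan hG _ _ _ _)
  let f : levelMatrices k G δ X N →ₗ[k] (i j : ι) → levelSpan k G X N (δ i) (δ j) :=
    { toFun := fun A i j => ⟨A.1 i j, A.2 i j⟩
      map_add' := fun _ _ => rfl
      map_smul' := fun _ _ => rfl }
  refine FiniteDimensional.of_injective f fun A B hAB => Subtype.ext ?_
  ext i j
  exact congrArg Subtype.val (congrFun (congrFun hAB i) j)

theorem mul_mem_levelMatrices [Fintype ι] {δ : ι → ℤ} {X : Finset V} {N : ℤ} {A B : Matrix ι ι (LPA k G)}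
    (hA : A ∈ levelMatrices k G δ X N) (hB : B ∈ levelMatrices k G δ X N) :
    A * B ∈ levelMatrices k G δ X N := fun i j => by
  rw [Matrix.mul_apply]
  exact sum_mem fun l _ => mul_mem_levelSpan (hA i l) (hB l j)

theorem eventually_mem_levelMatrices [Fintype ι] {δ : ι → ℤ} {A : Matrix ι ι (LPA k G)}
    (hA : IsDegZero (grading k G) δ δ A) :
    ∀ᶠ XN : Finset V × ℤ in atTop, A ∈ levelMatrices k G δ XN.1 XN.2 :=
  eventually_all.2 fun i => eventually_all.2 fun j => eventually_mem_levelSpan (hA i j)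

/-- The matrices with entries in an ideal. -/
def idealMatrices (ι κ : Type*) (I : TwoSidedIdeal (LPA k G)) :
    Submodule k (Matrix ι κ (LPA k G)) where
  carrier := {A | ∀ i j, A i j ∈ I}
  add_mem' hA hB i j := add_mem (hA i j) (hB i j)
  zero_mem' _ _ := zero_mem _
  smul_mem' c _ hA i j := smul_mem_ideal _ c (hA i j)

theorem mul_mem_idealMatrices_left [Fintype κ] {I : TwoSidedIdeal (LPA k G)} (A : Matrix ι κ (LPA k G))
    {B : Matrix κ τ (LPA k G)} (hB : B ∈ idealMatrices κ τ I) : A * B ∈ idealMatrices ι τ I :=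
  fun i j => by
    rw [Matrix.mul_apply]
    exact sum_mem fun l _ => I.mul_mem_left _ _ (hB l j)

theorem mul_mem_idealMatrices_right [Fintype κ] {I : TwoSidedIdeal (LPA k G)} {A : Matrix ι κ (LPA k G)}
    (B : Matrix κ τ (LPA k G)) (hA : A ∈ idealMatrices ι κ I) : A * B ∈ idealMatrices ι τ I :=
  fun i j => by
    rw [Matrix.mul_apply]
    exact sum_mem fun l _ => I.mul_mem_right _ _ (hA i l)

/-- Modulo an ideal, a homogeneous idempotent matrix over the Leavitt path algebra of a row-finite
graph is not equivalent to a proper subidempotent. -/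
theorem sub_mem_idealMatrices [Fintype ι] (hG : G.RowFinite) (I : TwoSidedIdeal (LPA k G)) {δ : ι → ℤ}
    {X Y P Q : Matrix ι ι (LPA k G)} (hX : IsDegZero (grading k G) δ δ X)
    (hY : IsDegZero (grading k G) δ δ Y) (hP : IsDegZero (grading k G) δ δ P)
    (hQ : IsDegZero (grading k G) δ δ Q) (hXY : X * Y - P ∈ idealMatrices ι ι I)
    (hYX : Y * X - Q ∈ idealMatrices ι ι I) (hPP : P * P = P) (hPQ : P * Q = Q) (hQP : Q * P = Q)
    (hQQ : Q * Q = Q) : Q - P ∈ idealMatrices ι ι I := by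
  classical
  -- One finite vertex set and one level bound serve all four matrices, which then act by left
  -- multiplication on a finite-dimensional space of matrices. The conclusion Q P - P is evaluated
  -- at the vector `P` itself.
  obtain ⟨⟨S, N⟩, hX, hY, hP, hQ⟩ :=
    ((eventually_mem_levelMatrices hX).and ((eventually_mem_levelMatrices hY).and
      ((eventually_mem_levelMatrices hP).and (eventually_mem_levelMatrices hQ)))).exists
  have := finiteDimensional_levelMatrices (k := k) hG δ S N
  have key := LinearMap.sub_mem_of_equivalent_idempotents (levelMatrices k G δ S N)
    (idealMatrices ι ι I) (X := LinearMap.mulLeft k X) (Y := LinearMap.mulLeft k Y)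
    (P := LinearMap.mulLeft k P) (Q := LinearMap.mulLeft k Q)
    (fun _ => mul_mem_levelMatrices hX) (fun _ => mul_mem_levelMatrices hY)
    (fun _ => mul_mem_levelMatrices hP) (fun _ => mul_mem_levelMatrices hQ)
    (fun _ => mul_mem_idealMatrices_left _) (fun _ => mul_mem_idealMatrices_left _)
    (fun _ => mul_mem_idealMatrices_left _) (fun _ => mul_mem_idealMatrices_left _)
    (fun A _ => ?_) (fun A _ => ?_) (fun A => ?_) (fun A => ?_) (fun A => ?_) hP
  · simpa only [LinearMap.mulLeft_apply, hPP, hQP] using key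
  all_goals simp only [LinearMap.mulLeft_apply, ← Matrix.mul_assoc, ← Matrix.sub_mul]
  · exact mul_mem_idealMatrices_right _ hXY
  · exact mul_mem_idealMatrices_right _ hYX
  · rw [hPP]
  · rw [hPQ]
  · rw [hQQ]

end LPA

/-! ### Classes in `V^gr(I)` are detected by matrix entries -/

theorem Vgr.mk_add_mk_eq {R : Type*} [NonUnitalRing R] {𝒜 : ℤ → AddSubgroup R}
    [SetLike.GradedMul 𝒜] {a b c d : GradedIdem 𝒜} :
    Vgr.mk a + Vgr.mk b = Vgr.mk c + Vgr.mk d ↔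
      GradedEquiv 𝒜 (Sum.elim a.δ b.δ) (Sum.elim c.δ d.δ) (Matrix.fromBlocks a.p 0 0 b.p)
        (Matrix.fromBlocks c.p 0 0 d.p) := by
  rw [← Vgr.mk_add, ← Vgr.mk_add]
  constructor
  · intro h
    have h' : GradedIdem.Rel (a.add b) (c.add d) := Quotient.exact h
    exact (GradedIdem.blocks_equiv_add a b).trans (fromBlocks_idem a.idem b.idem)
      (fromBlocks_idem c.idem d.idem)
      (h'.trans (a.add b).idem (fromBlocks_idem c.idem d.idem)
        (GradedIdem.blocks_equiv_add c d).symm)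
  · intro h
    exact Quotient.sound ((GradedIdem.blocks_equiv_add a b).symm.trans (a.add b).idem
      (c.add d).idem (h.trans (fromBlocks_idem a.idem b.idem) (c.add d).idem
        (GradedIdem.blocks_equiv_add c d)))

theorem K0gr.of_eq_of {R : Type*} [NonUnitalRing R] {𝒜 : ℤ → AddSubgroup R}
    [SetLike.GradedMul 𝒜] {x y : Vgr 𝒜} : K0gr.of x = K0gr.of y ↔ ∃ z, x + z = y + z := by
  refine ((AddLocalization.addMonoidOf (⊤ : AddSubmonoid (Vgr 𝒜))).eq_iff_exists).trans ?_
  exact ⟨fun ⟨c, h⟩ => ⟨c, by rw [add_comm x, add_comm y]; exact h⟩,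
    fun ⟨c, h⟩ => ⟨⟨c, trivial⟩, by rw [add_comm x, add_comm y] at h; exact h⟩⟩

namespace LPA

variable {k : Type*} [Field k] {V E : Type*} {G : DirGraph V E}

/-- Modulo `I` the summand c disappears, so P = a ⊕ d becomes equivalent to its subidempotent Q = 0
⊕ d. Stable finiteness gives Q ≡ P, and the upper left block of Q - P is -a. -/
theorem mem_of_mk_add_mk_eq (hG : G.RowFinite) (I : TwoSidedIdeal (LPA k G))
    {a c d : GradedIdem (grading k G)} (h : Vgr.mk a + Vgr.mk d = Vgr.mk c + Vgr.mk d)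
    (hc : ∀ i j, c.p i j ∈ I) (i j : Fin a.n) : a.p i j ∈ I := by
  obtain ⟨x, y, hx, hy, hxy, hyx⟩ := Vgr.mk_add_mk_eq.1 h
  obtain ⟨x₁, x₂, rfl⟩ : ∃ x₁ x₂, x = Matrix.fromCols x₁ x₂ :=
    ⟨_, _, (Matrix.fromCols_toCols x).symm⟩
  obtain ⟨y₁, y₂, rfl⟩ : ∃ y₁ y₂, y = Matrix.fromRows y₁ y₂ :=
    ⟨_, _, (Matrix.fromRows_toRows y).symm⟩
  rw [Matrix.fromCols_mul_fromRows_nonUnital] at hxy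
  rw [Matrix.fromRows_mul_fromCols_nonUnital, Matrix.fromBlocks_inj] at hyx
  obtain ⟨h11, h12, h21, h22⟩ := hyx
  have hx₂ : IsDegZero (grading k G) (Sum.elim a.δ d.δ) d.δ x₂ := fun i j => hx i (.inr j)
  have hy₂ : IsDegZero (grading k G) d.δ (Sum.elim a.δ d.δ) y₂ := fun i j => hy (.inr i) j
  have hP := a.degZero.fromBlocks d.degZero
  have hPP := fromBlocks_idem a.idem d.idem
  set P := Matrix.fromBlocks a.p 0 0 d.p
  -- Expand P = P² = (x₁ y₁ + x₂ y₂)², using y₁ x₁ = c, y₂ x₂ = d and the vanishing of the cross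
  -- terms.
  have hPe : P - x₂ * d.p * y₂ = x₁ * c.p * y₁ := by
    conv_lhs => rw [← hPP, ← hxy]
    have e : (x₁ * y₁ + x₂ * y₂) * (x₁ * y₁ + x₂ * y₂) = x₁ * (y₁ * x₁) * y₁ +
        x₁ * (y₁ * x₂) * y₂ + (x₂ * (y₂ * x₁) * y₁ + x₂ * (y₂ * x₂) * y₂) := by
      simp only [Matrix.add_mul, Matrix.mul_add, Matrix.mul_assoc]
      abel
    rw [e, h11, h12, h21, h22]
    simp
  -- Zero blocks pad x₂ d and y₂ to square matrices. Then Y X = Q holds exactly, while X Y = x₂ d y₂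
  -- agrees with P modulo `I`.
  have key := sub_mem_idealMatrices hG I (δ := Sum.elim a.δ d.δ)
    (X := Matrix.fromCols 0 (x₂ * d.p)) (Y := Matrix.fromRows 0 y₂) (P := P)
    (Q := Matrix.fromBlocks 0 0 0 d.p) ?_ ?_ hP ?_ ?_ ?_ hPP ?_ ?_ ?_
  · have h0 : 0 - a.p i j ∈ I := key (.inl i) (.inl j)
    simpa using neg_mem h0
  · rintro i (j | j)
    · exact zero_mem _
    · exact hx₂.mul d.degZero i j
  · rintro (i | i) j
    · exact zero_mem _
    · exact hy₂ i j
  · rintro (i | i) (j | j)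
    exacts [zero_mem _, zero_mem _, zero_mem _, d.degZero i j]
  · rw [Matrix.fromCols_mul_fromRows_nonUnital, Matrix.zero_mul, zero_add, ← neg_sub, hPe]
    exact neg_mem (mul_mem_idealMatrices_right _ (mul_mem_idealMatrices_left _ hc))
  · rw [Matrix.fromRows_mul_fromCols_nonUnital, ← Matrix.mul_assoc y₂, h22, d.idem]
    simp only [Matrix.zero_mul, Matrix.mul_zero, sub_self]
    exact zero_mem _
  all_goals simp [P, Matrix.fromBlocks_multiply, d.idem]

/-- The class of a homogeneous idempotent lies in `V^gr(I)` iff its entries lie in `I`. -/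
theorem of_mk_mem_vgr (hG : G.RowFinite) {I : GradedIdeal k G} {a : GradedIdem (grading k G)} :
    K0gr.of (Vgr.mk a) ∈ I.vgr ↔ ∀ i j, a.p i j ∈ I.ideal := by
  constructor
  · rintro ⟨v, hv⟩
    obtain ⟨b, rfl⟩ := Vgr.mk_surjective v
    obtain ⟨d, hd⟩ := K0gr.of_eq_of.1 hv.symm
    obtain ⟨d, rfl⟩ := Vgr.mk_surjective d
    exact mem_of_mk_add_mk_eq hG I.ideal hd fun i j => (b.p i j).2
  · intro h
    let b : GradedIdem I.grading :=
      { n := a.n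
        δ := a.δ
        p := Matrix.of fun i j => ⟨a.p i j, h i j⟩
        degZero := a.degZero
        idem := by
          ext i j
          have := congrFun (congrFun a.idem i) j
          rw [Matrix.mul_apply] at this ⊢
          rw [AddSubmonoidClass.coe_finsetSum]
          exact this }
    exact ⟨Vgr.mk b, rfl⟩

theorem vgr_subset_positiveCone (I : GradedIdeal k G) :
    I.vgr ⊆ K0gr.positiveCone (grading k G) := by
  rintro _ ⟨v, rfl⟩
  exact ⟨_, rfl⟩

end LPA

/-! ## Order ideals of the graded Grothendieck group -/

namespace K0gr

variable {R : Type*} [NonUnitalRing R] {𝒜 : ℤ → AddSubgroup R} [SetLike.GradedMul 𝒜]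

/-- A shift-invariant hereditary submonoid of the positive cone. -/
structure IsOrderIdeal (S : Set (K0gr 𝒜)) : Prop where
  subset : S ⊆ positiveCone 𝒜
  zero_mem : (0 : K0gr 𝒜) ∈ S
  add_mem : ∀ {a b}, a ∈ S → b ∈ S → a + b ∈ S
  of_add_mem : ∀ {a b}, a ∈ positiveCone 𝒜 → b ∈ positiveCone 𝒜 → a + b ∈ S → a ∈ S
  smul_mem : ∀ (n : ℤ) {a}, a ∈ S → (LaurentPolynomial.T n : LaurentPolynomial ℤ) • a ∈ S

theorem mem_positiveCone_iff {x : K0gr 𝒜} : x ∈ positiveCone 𝒜 ↔ ∃ a, of (Vgr.mk a) = x := by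
  constructor
  · rintro ⟨v, rfl⟩
    obtain ⟨a, rfl⟩ := Vgr.mk_surjective v
    exact ⟨a, rfl⟩
  · rintro ⟨a, rfl⟩
    exact ⟨_, rfl⟩

theorem mem_positiveCone_iff_nonneg {x : K0gr 𝒜} : x ∈ positiveCone 𝒜 ↔ 0 ≤ x := by
  rw [le_iff, sub_zero]

variable {R' : Type*} [NonUnitalRing R'] {ℬ : ℤ → AddSubgroup R'} [SetLike.GradedMul ℬ]

theorem IsOrderIdeal.image (φ : K0gr 𝒜 ≃ₗ[LaurentPolynomial ℤ] K0gr ℬ)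
    (hφ : ∀ a b, φ a ≤ φ b ↔ a ≤ b) {S : Set (K0gr 𝒜)} (hS : IsOrderIdeal S) :
    IsOrderIdeal (φ '' S) := by
  -- The cone is the set of x with 0 ≤ x, so it is both preserved and reflected; reflection is
  -- needed for heredity of the image.
  have hpos (a : K0gr 𝒜) : φ a ∈ positiveCone ℬ ↔ a ∈ positiveCone 𝒜 := by
    rw [mem_positiveCone_iff_nonneg, mem_positiveCone_iff_nonneg, ← hφ, map_zero]
  constructor
  · rintro _ ⟨a, ha, rfl⟩
    exact (hpos a).2 (hS.subset ha)
  · exact ⟨0, hS.zero_mem, map_zero φ⟩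
  · rintro _ _ ⟨a, ha, rfl⟩ ⟨b, hb, rfl⟩
    exact ⟨a + b, hS.add_mem ha hb, map_add φ a b⟩
  · intro a b ha hb h
    obtain ⟨a, rfl⟩ := φ.surjective a
    obtain ⟨b, rfl⟩ := φ.surjective b
    obtain ⟨c, hc, hcab⟩ := h
    rw [← map_add, φ.injective.eq_iff] at hcab
    subst hcab
    exact ⟨a, hS.of_add_mem ((hpos a).1 ha) ((hpos b).1 hb) hc, rfl⟩
  · rintro n _ ⟨a, ha, rfl⟩
    exact ⟨_, hS.smul_mem n ha, map_smul φ _ a⟩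

/-- An order isomorphism of `ℤ[x, x⁻¹]`-modules acts on the order ideals. -/
def orderIdealIso (φ : K0gr 𝒜 ≃ₗ[LaurentPolynomial ℤ] K0gr ℬ) (hφ : ∀ a b, φ a ≤ φ b ↔ a ≤ b) :
    {S : Set (K0gr 𝒜) // IsOrderIdeal S} ≃o {S : Set (K0gr ℬ) // IsOrderIdeal S} where
  toFun S := ⟨φ '' S.1, S.2.image φ hφ⟩
  invFun S := ⟨φ.symm '' S.1, S.2.image φ.symm fun a b => by
    rw [← hφ, φ.apply_symm_apply, φ.apply_symm_apply]⟩
  left_inv S := Subtype.ext (φ.toEquiv.symm_image_image S.1)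
  right_inv S := Subtype.ext (φ.toEquiv.image_symm_image S.1)
  map_rel_iff' {S T} := Set.image_subset_image_iff φ.injective

end K0gr

/-! ### Factoring through idempotents and splitting off direct summands -/

theorem Matrix.mul_mul_add_mul_mul_eq_submatrix {R ι κ μ ν τ : Type*} [NonUnitalRing R]
    [Fintype μ] [Fintype ν] [Fintype τ] (e : μ ⊕ ν ≃ τ) (X : Matrix ι μ R) (P : Matrix μ μ R)
    (Y : Matrix μ κ R) (X' : Matrix ι ν R) (P' : Matrix ν ν R) (Y' : Matrix ν κ R) :
    X * P * Y + X' * P' * Y' = (fromCols X X').submatrix id e.symm *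
      (fromBlocks P 0 0 P').submatrix e.symm e.symm * (fromRows Y Y').submatrix e.symm id := by
  rw [submatrix_mul_equiv, submatrix_mul_equiv, submatrix_id_id]
  ext i j
  simp [mul_apply]

theorem IsDegZero.single {R ι κ : Type*} [NonUnitalRing R] {𝒜 : ℤ → AddSubgroup R}
    [DecidableEq ι] [DecidableEq κ] {δ : ι → ℤ} {σ : κ → ℤ} {i : ι} {j : κ} {u : R}
    (hu : u ∈ 𝒜 (σ j - δ i)) : IsDegZero 𝒜 δ σ (Matrix.single i j u) := by
  intro i' j'
  rw [Matrix.single_apply]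
  split_ifs with h
  · obtain ⟨rfl, rfl⟩ := h
    exact hu
  · exact zero_mem _

section Splitting

variable {R : Type*} [NonUnitalRing R] {𝒜 : ℤ → AddSubgroup R} [SetLike.GradedMul 𝒜]

/-- An idempotent that factors through the idempotent `c` is equivalent to a direct summand
of `c`. -/
theorem Vgr.exists_mk_add_eq {b c : GradedIdem 𝒜} {X : Matrix (Fin b.n) (Fin c.n) R}
    {Y : Matrix (Fin c.n) (Fin b.n) R} (hX : IsDegZero 𝒜 b.δ c.δ X) (hY : IsDegZero 𝒜 c.δ b.δ Y)
    (h : b.p = X * c.p * Y) : ∃ r : GradedIdem 𝒜, Vgr.mk b + Vgr.mk r = Vgr.mk c := by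
  have hb := b.idem
  have hc := c.idem
  -- Cutting X and Y down to the corners of b and c yields x y = b, with y x a subidempotent of c.
  -- The complement c - y x is the other summand.
  obtain ⟨x, hx⟩ : ∃ x, x = b.p * X * c.p := ⟨_, rfl⟩
  obtain ⟨y, hy⟩ : ∃ y, y = c.p * Y * b.p := ⟨_, rfl⟩
  have hbx : b.p * x = x := by rw [hx, ← Matrix.mul_assoc, ← Matrix.mul_assoc, hb]
  have hyb : y * b.p = y := by rw [hy, Matrix.mul_assoc, hb]
  have hxc : x * c.p = x := by rw [hx, Matrix.mul_assoc, hc]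
  have hcy : c.p * y = y := by rw [hy, ← Matrix.mul_assoc, ← Matrix.mul_assoc, hc]
  have hxy : x * y = b.p := by
    calc x * y = b.p * (X * (c.p * c.p) * Y) * b.p := by rw [hx, hy]; simp only [Matrix.mul_assoc]
      _ = b.p := by rw [hc, ← h, hb, hb]
  have hxd : IsDegZero 𝒜 b.δ c.δ x := hx ▸ (b.degZero.mul hX).mul c.degZero
  have hyd : IsDegZero 𝒜 c.δ b.δ y := hy ▸ (c.degZero.mul hY).mul b.degZero
  have hxr : x * (c.p - y * x) = 0 := by
    rw [Matrix.mul_sub, hxc, ← Matrix.mul_assoc, hxy, hbx, sub_self]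
  have hry : (c.p - y * x) * y = 0 := by
    rw [Matrix.sub_mul, hcy, Matrix.mul_assoc, hxy, hyb, sub_self]
  have hrr : (c.p - y * x) * (c.p - y * x) = c.p - y * x := by
    conv_lhs => rw [Matrix.mul_sub, ← Matrix.mul_assoc _ y x, hry, Matrix.zero_mul, sub_zero,
      Matrix.sub_mul, hc, Matrix.mul_assoc, hxc]
  let r : GradedIdem 𝒜 :=
    { n := c.n
      δ := c.δ
      p := c.p - y * x
      degZero := fun i j => sub_mem (c.degZero i j) (hyd.mul hxd i j)
      idem := hrr }
  refine ⟨r, ?_⟩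
  rw [← Vgr.mk_add]
  -- With r = c - y x, the column (x, r) and the row (y, r) implement b ⊕ r ~ c: the cross terms x r
  -- and r y vanish, and y x + r = c.
  refine Quotient.sound ((GradedIdem.blocks_equiv_add b r).symm.trans (b.add r).idem c.idem
    ⟨Matrix.fromRows x r.p, Matrix.fromCols y r.p, ?_, ?_, ?_, ?_⟩)
  · rintro (i | i) j
    exacts [hxd i j, r.degZero i j]
  · rintro i (j | j)
    exacts [hyd i j, r.degZero i j]
  · rw [Matrix.fromRows_mul_fromCols_nonUnital, hxy, r.idem]
    change Matrix.fromBlocks _ (x * (c.p - y * x)) ((c.p - y * x) * y) _ = _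
    rw [hxr, hry]
  · rw [Matrix.fromCols_mul_fromRows_nonUnital, r.idem]
    exact add_sub_cancel _ _

/-- A homogeneous matrix factors through a homogeneous idempotent whose class lies in `S`. -/
def FactorsThrough {ι κ : Type*} (S : Set (K0gr 𝒜)) (δ : ι → ℤ) (σ : κ → ℤ) (b : Matrix ι κ R) :
    Prop :=
  ∃ c : GradedIdem 𝒜, K0gr.of (Vgr.mk c) ∈ S ∧ ∃ X Y, IsDegZero 𝒜 δ c.δ X ∧
    IsDegZero 𝒜 c.δ σ Y ∧ b = X * c.p * Y

namespace FactorsThrough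

variable {ι κ : Type*} {S : Set (K0gr 𝒜)} {δ : ι → ℤ} {σ : κ → ℤ} {b b' : Matrix ι κ R}

theorem zero (hS : K0gr.IsOrderIdeal S) : FactorsThrough S δ σ (0 : Matrix ι κ R) := by
  have h0 : K0gr.of (Vgr.mk (GradedIdem.zero 𝒜)) = 0 := map_zero K0gr.of
  exact ⟨GradedIdem.zero 𝒜, h0 ▸ hS.zero_mem, 0, 0, fun _ _ => zero_mem _, fun _ _ => zero_mem _,
    (Matrix.mul_zero _).symm⟩

theorem neg (h : FactorsThrough S δ σ b) : FactorsThrough S δ σ (-b) := by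
  obtain ⟨c, hc, X, Y, hX, hY, rfl⟩ := h
  exact ⟨c, hc, -X, Y, fun i j => neg_mem (hX i j), hY, by rw [Matrix.neg_mul, Matrix.neg_mul]⟩

/-- X c Y + X' c' Y' factors through c ⊕ c', whose class stays in `S` because `S` is a submonoid. -/
theorem add (hS : K0gr.IsOrderIdeal S) (h : FactorsThrough S δ σ b)
    (h' : FactorsThrough S δ σ b') : FactorsThrough S δ σ (b + b') := by
  obtain ⟨c, hc, X, Y, hX, hY, rfl⟩ := h
  obtain ⟨c', hc', X', Y', hX', hY', rfl⟩ := h'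
  refine ⟨c.add c', ?_, (Matrix.fromCols X X').submatrix id finSumFinEquiv.symm,
    (Matrix.fromRows Y Y').submatrix finSumFinEquiv.symm id, fun i j => ?_, fun i j => ?_, ?_⟩
  · rw [Vgr.mk_add, map_add]; exact hS.add_mem hc hc'
  · change Matrix.fromCols X X' i (finSumFinEquiv.symm j) ∈
      𝒜 (Sum.elim c.δ c'.δ (finSumFinEquiv.symm j) - δ i)
    rcases finSumFinEquiv.symm j with j | j
    exacts [hX i j, hX' i j]
  · change Matrix.fromRows Y Y' (finSumFinEquiv.symm i) j ∈
      𝒜 (σ j - Sum.elim c.δ c'.δ (finSumFinEquiv.symm i))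
    rcases finSumFinEquiv.symm i with i | i
    exacts [hY i j, hY' i j]
  · exact Matrix.mul_mul_add_mul_mul_eq_submatrix finSumFinEquiv _ _ _ _ _ _

theorem sum (hS : K0gr.IsOrderIdeal S) {α : Type*} (t : Finset α) (f : α → Matrix ι κ R)
    (h : ∀ i ∈ t, FactorsThrough S δ σ (f i)) : FactorsThrough S δ σ (∑ i ∈ t, f i) :=
  Finset.sum_induction f _ (fun _ _ => add hS) (zero hS) h

/-- The matrix with sole entry u p_st w is E_is(u) p E_tj(w). The shift m + δ i - a.δ s is the one
that makes E_is(u) of degree zero, and `h` then does the same for E_tj(w). This is where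
shift-invariance of `S` is used. -/
theorem single [DecidableEq ι] [DecidableEq κ] (hS : K0gr.IsOrderIdeal S) {a : GradedIdem 𝒜}
    (ha : K0gr.of (Vgr.mk a) ∈ S) (s t : Fin a.n) {m l : ℤ} {u w : R} (hu : u ∈ 𝒜 m)
    (hw : w ∈ 𝒜 l) (i : ι) (j : κ) (h : m + (a.δ t - a.δ s) + l = σ j - δ i) :
    FactorsThrough S δ σ (Matrix.single i j (u * a.p s t * w)) := by
  refine ⟨a.shift (m + δ i - a.δ s), ?_, Matrix.single i s u, Matrix.single t j w, ?_, ?_, ?_⟩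
  · have := hS.smul_mem (m + δ i - a.δ s) ha
    rwa [K0gr.T_smul_of] at this
  · exact IsDegZero.single (σ := fun s' => a.δ s' + (m + δ i - a.δ s)) (by convert hu using 2; ring)
  · exact IsDegZero.single (δ := fun s' => a.δ s' + (m + δ i - a.δ s))
      (by convert hw using 2; linarith)
  · ext i' j'
    change _ = (Matrix.single i s u * a.p * Matrix.single t j w) i' j'
    by_cases h1 : i = i' <;> by_cases h2 : j = j' <;>
      simp [Matrix.mul_apply, Matrix.single_apply, h1, h2]

theorem mem {b : GradedIdem 𝒜} (hS : K0gr.IsOrderIdeal S) (h : FactorsThrough S b.δ b.δ b.p) :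
    K0gr.of (Vgr.mk b) ∈ S := by
  obtain ⟨c, hc, X, Y, hX, hY, h⟩ := h
  obtain ⟨r, hr⟩ := Vgr.exists_mk_add_eq hX hY h
  refine hS.of_add_mem ⟨_, rfl⟩ ⟨Vgr.mk r, rfl⟩ ?_
  rwa [← map_add, hr]

end FactorsThrough

end Splitting

/-! ### The correspondence between graded ideals and order ideals -/

namespace GradedIdeal

variable {k : Type*} [Field k] {V E : Type*} {G : DirGraph V E}

/-- Heredity and shift-invariance are read off from the entries: a diagonal block of a matrix over
`I` is again over `I`, and a shift leaves the matrix unchanged. -/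
theorem isOrderIdeal_vgr (hG : G.RowFinite) (I : GradedIdeal k G) : K0gr.IsOrderIdeal I.vgr := by
  have hsub := LPA.vgr_subset_positiveCone I
  refine ⟨hsub, ?_, ?_, ?_, ?_⟩
  · exact ⟨0, (K0gr.of.comp (Vgr.map (NonUnitalSubringClass.subtype I.toSubring)
      fun _ _ h => h)).map_zero⟩
  · rintro _ _ ⟨v, rfl⟩ ⟨w, rfl⟩
    exact ⟨v + w, (K0gr.of.comp (Vgr.map (NonUnitalSubringClass.subtype I.toSubring)
      fun _ _ h => h)).map_add v w⟩
  · intro a b ha hb h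
    obtain ⟨a, rfl⟩ := K0gr.mem_positiveCone_iff.1 ha
    obtain ⟨b, rfl⟩ := K0gr.mem_positiveCone_iff.1 hb
    rw [← map_add, ← Vgr.mk_add, LPA.of_mk_mem_vgr hG] at h
    refine (LPA.of_mk_mem_vgr hG).2 fun i j => ?_
    have := h (finSumFinEquiv (.inl i)) (finSumFinEquiv (.inl j))
    simpa [GradedIdem.add] using this
  · intro n a ha
    obtain ⟨a, rfl⟩ := K0gr.mem_positiveCone_iff.1 (hsub ha)
    rw [K0gr.T_smul_of]
    rw [LPA.of_mk_mem_vgr hG] at ha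
    exact (LPA.of_mk_mem_vgr (a := a.shift n) hG).2 ha

/-- The homogeneous elements `u p w` with `p` an entry of an idempotent whose class is in `S`. -/
def orderIdealGenerators (S : Set (K0gr (LPA.grading k G))) : Set (LPA k G) :=
  {c | ∃ a : GradedIdem (LPA.grading k G), K0gr.of (Vgr.mk a) ∈ S ∧ ∃ s t, ∃ m l : ℤ,
    ∃ u ∈ LPA.grading k G m, ∃ w ∈ LPA.grading k G l, c = u * a.p s t * w}

theorem mul_mem_closure_generators_left {S : Set (K0gr (LPA.grading k G))} {x y : LPA k G}
    (hy : y ∈ AddSubgroup.closure (orderIdealGenerators S)) :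
    x * y ∈ AddSubgroup.closure (orderIdealGenerators S) := by
  induction hy using AddSubgroup.closure_induction with
  | zero => rw [mul_zero]; exact zero_mem _
  | add y z _ _ hy hz => rw [mul_add]; exact add_mem hy hz
  | neg y _ hy => rw [mul_neg]; exact neg_mem hy
  | mem y hy =>
    obtain ⟨a, ha, s, t, m, l, u, hu, w, hw, rfl⟩ := hy
    induction LPA.mem_closure_grading k G x using AddSubgroup.closure_induction with
    | zero => rw [zero_mul]; exact zero_mem _
    | add y z _ _ hy hz => rw [add_mul]; exact add_mem hy hz
    | neg y _ hy => rw [neg_mul]; exact neg_mem hy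
    | mem x hx =>
      obtain ⟨n, hn⟩ := hx
      exact AddSubgroup.subset_closure ⟨a, ha, s, t, _, l, x * u,
        SetLike.GradedMul.mul_mem hn hu, w, hw, by simp only [mul_assoc]⟩

theorem mul_mem_closure_generators_right {S : Set (K0gr (LPA.grading k G))} {x y : LPA k G}
    (hx : x ∈ AddSubgroup.closure (orderIdealGenerators S)) :
    x * y ∈ AddSubgroup.closure (orderIdealGenerators S) := by
  induction hx using AddSubgroup.closure_induction with
  | zero => rw [zero_mul]; exact zero_mem _
  | add y z _ _ hy hz => rw [add_mul]; exact add_mem hy hz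
  | neg y _ hy => rw [neg_mul]; exact neg_mem hy
  | mem x hx =>
    obtain ⟨a, ha, s, t, m, l, u, hu, w, hw, rfl⟩ := hx
    induction LPA.mem_closure_grading k G y using AddSubgroup.closure_induction with
    | zero => rw [mul_zero]; exact zero_mem _
    | add y z _ _ hy hz => rw [mul_add]; exact add_mem hy hz
    | neg y _ hy => rw [mul_neg]; exact neg_mem hy
    | mem y hy =>
      obtain ⟨n, hn⟩ := hy
      exact AddSubgroup.subset_closure ⟨a, ha, s, t, m, _, u, hu, w * y,
        SetLike.GradedMul.mul_mem hw hn, by simp only [mul_assoc]⟩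

theorem mem_grading_of_generator {S : Set (K0gr (LPA.grading k G))} {c : LPA k G}
    (hc : c ∈ orderIdealGenerators S) : ∃ n, c ∈ LPA.grading k G n := by
  obtain ⟨a, ha, s, t, m, l, u, hu, w, hw, rfl⟩ := hc
  exact ⟨_, SetLike.GradedMul.mul_mem (SetLike.GradedMul.mul_mem hu (a.degZero s t)) hw⟩

/-- The ideal generated by the entries of the idempotents whose classes lie in `S`. -/
def idealOfOrderIdeal (S : Set (K0gr (LPA.grading k G))) : TwoSidedIdeal (LPA k G) :=
  TwoSidedIdeal.mk' (AddSubgroup.closure (orderIdealGenerators S) : Set (LPA k G)) (zero_mem _)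
    add_mem neg_mem mul_mem_closure_generators_left mul_mem_closure_generators_right

theorem mem_idealOfOrderIdeal {S : Set (K0gr (LPA.grading k G))} {a : LPA k G} :
    a ∈ idealOfOrderIdeal S ↔ a ∈ AddSubgroup.closure (orderIdealGenerators S) := by
  rw [idealOfOrderIdeal, TwoSidedIdeal.mem_mk', SetLike.mem_coe]

/-- The ideal generated by the entries of the idempotents whose classes lie in `S`, as a graded
ideal. -/
def ofOrderIdeal (S : Set (K0gr (LPA.grading k G))) : GradedIdeal k G :=
  ⟨idealOfOrderIdeal S, fun a ha => by
    refine AddSubgroup.closure_mono (fun b hb => ?_) (mem_idealOfOrderIdeal.1 ha)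
    exact ⟨mem_idealOfOrderIdeal.2 (AddSubgroup.subset_closure hb), mem_grading_of_generator hb⟩⟩

theorem mem_ofOrderIdeal {S : Set (K0gr (LPA.grading k G))} {a : LPA k G} :
    a ∈ (ofOrderIdeal S).ideal ↔ a ∈ AddSubgroup.closure (orderIdealGenerators S) :=
  mem_idealOfOrderIdeal

theorem entry_mem_ofOrderIdeal {S : Set (K0gr (LPA.grading k G))}
    {a : GradedIdem (LPA.grading k G)} (ha : K0gr.of (Vgr.mk a) ∈ S) (i j : Fin a.n) :
    a.p i j ∈ (ofOrderIdeal S).ideal := by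
  rw [mem_ofOrderIdeal]
  -- Without a unit, the homogeneous outer factors u and w of a generator are supplied by p = p³.
  have h : a.p i j = (a.p * a.p * a.p) i j := by rw [a.idem, a.idem]
  rw [h, Matrix.mul_apply]
  refine sum_mem fun t _ => ?_
  rw [Matrix.mul_apply, Finset.sum_mul]
  refine sum_mem fun s _ => AddSubgroup.subset_closure
    ⟨a, ha, s, t, _, _, _, a.degZero i s, _, a.degZero t j, rfl⟩

/-- Factorizations add up, so it suffices to treat one entry, and there one generator. Directness of
the grading allows each entry to be written with generators of its own degree only. -/
theorem factorsThrough_of_mem_ofOrderIdeal {ι κ : Type*} [Fintype ι] [Fintype κ]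
    {S : Set (K0gr (LPA.grading k G))} (hS : K0gr.IsOrderIdeal S) {δ : ι → ℤ} {σ : κ → ℤ}
    {b : Matrix ι κ (LPA k G)} (hb : IsDegZero (LPA.grading k G) δ σ b)
    (hbS : ∀ i j, b i j ∈ (ofOrderIdeal S).ideal) : FactorsThrough S δ σ b := by
  classical
  rw [Matrix.matrix_eq_sum_single b]
  refine .sum hS _ _ fun i _ => .sum hS _ _ fun j _ => ?_
  have := LPA.mem_closure_of_mem_grading (fun c => mem_grading_of_generator)
    (mem_ofOrderIdeal.1 (hbS i j)) (hb i j)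
  generalize b i j = c at this ⊢
  induction this using AddSubgroup.closure_induction with
  | zero => rw [Matrix.single_zero]; exact .zero hS
  | add y z _ _ hy hz => rw [Matrix.single_add]; exact hy.add hS hz
  | neg y _ hy =>
    rw [← Matrix.singleAddMonoidHom_apply, map_neg]
    exact hy.neg
  | mem c hc =>
    obtain ⟨⟨a, ha, s, t, m, l, u, hu, w, hw, rfl⟩, hd⟩ := hc
    by_cases h : m + (a.δ t - a.δ s) + l = σ j - δ i
    · exact .single hS ha s t hu hw i j h
    -- The generator lies in two different components, hence is zero.
    · have hd' := SetLike.GradedMul.mul_mem (SetLike.GradedMul.mul_mem hu (a.degZero s t)) hw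
      rw [← LPA.proj_self hd, LPA.proj_ne h hd', Matrix.single_zero]
      exact .zero hS

theorem vgr_ofOrderIdeal (hG : G.RowFinite) {S : Set (K0gr (LPA.grading k G))}
    (hS : K0gr.IsOrderIdeal S) : (ofOrderIdeal S).vgr = S := by
  ext x
  constructor
  · intro hx
    obtain ⟨a, rfl⟩ := K0gr.mem_positiveCone_iff.1 (LPA.vgr_subset_positiveCone _ hx)
    exact (factorsThrough_of_mem_ofOrderIdeal hS a.degZero
      ((LPA.of_mk_mem_vgr hG).1 hx)).mem hS
  · intro hx
    obtain ⟨a, rfl⟩ := K0gr.mem_positiveCone_iff.1 (hS.subset hx)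
    exact (LPA.of_mk_mem_vgr hG).2 (entry_mem_ofOrderIdeal hx)

variable (k G) in
/-- A vertex, as a homogeneous idempotent `1 × 1` matrix. -/
def vtxIdem (v : V) : GradedIdem (LPA.grading k G) where
  n := 1
  δ := 0
  p := Matrix.of fun _ _ => LPA.vtx k G v
  degZero _ _ := Submodule.subset_span ⟨FreeSemigroup.of (.vertex v), rfl, rfl⟩
  idem := by ext i j; simp [Matrix.mul_apply, LPA.vtx_mul_vtx_self]

/-- `I` is generated by its vertices, and a vertex lies in an ideal exactly when its class lies in
the corresponding `vgr`; comparing vertices is enough. -/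
theorem vgr_subset_vgr_iff (hG : G.RowFinite) {I J : GradedIdeal k G} :
    I.vgr ⊆ J.vgr ↔ I ≤ J := by
  constructor
  · intro h a ha
    refine (AddSubgroup.closure_le (AddSubgroup.ofClass J.ideal)).2 ?_ (LPA.mem_vertexSums hG I ha)
    rintro _ ⟨v, u, w, hv, rfl⟩
    have h1 : K0gr.of (Vgr.mk (vtxIdem k G v)) ∈ I.vgr := (LPA.of_mk_mem_vgr hG).2 fun _ _ => hv
    have h2 := (LPA.of_mk_mem_vgr hG).1 (h h1) (0 : Fin 1) (0 : Fin 1)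
    exact J.ideal.mul_mem_right _ _ (J.ideal.mul_mem_left _ _ h2)
  · intro h x hx
    obtain ⟨a, rfl⟩ := K0gr.mem_positiveCone_iff.1 (LPA.vgr_subset_positiveCone _ hx)
    exact (LPA.of_mk_mem_vgr hG).2 fun i j => h ((LPA.of_mk_mem_vgr hG).1 hx i j)

/-- The lattice of graded ideals is isomorphic to that of the order ideals of `K_0^gr`. -/
def orderIsoOrderIdeals (hG : G.RowFinite) :
    GradedIdeal k G ≃o {S : Set (K0gr (LPA.grading k G)) // K0gr.IsOrderIdeal S} where
  toFun I := ⟨I.vgr, I.isOrderIdeal_vgr hG⟩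
  invFun S := ofOrderIdeal S.1
  left_inv I := by
    have h := vgr_ofOrderIdeal hG (I.isOrderIdeal_vgr hG)
    exact le_antisymm ((vgr_subset_vgr_iff hG).1 h.subset) ((vgr_subset_vgr_iff hG).1 h.superset)
  right_inv S := Subtype.ext (vgr_ofOrderIdeal hG S.2)
  map_rel_iff' := vgr_subset_vgr_iff hG

/-- The graded prime ideals are the meet-prime elements of the lattice of graded ideals. -/
theorem isPrime_iff (hG : G.RowFinite) {P : GradedIdeal k G} :
    P.IsPrime ↔ (∃ Q, ¬ Q ≤ P) ∧ ∀ I J : GradedIdeal k G, I ⊓ J ≤ P → I ≤ P ∨ J ≤ P := by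
  refine and_congr ?_ (forall_congr' fun I => forall_congr' fun J => imp_congr_left ?_)
  · constructor
    · intro h
      refine ⟨⟨⊤, top_isGraded⟩, fun h' => h (top_le_iff.1 ?_)⟩
      exact fun a ha => h' ha
    · rintro ⟨Q, hQ⟩ h
      refine hQ fun a _ => ?_
      change a ∈ P.ideal
      rw [h]
      trivial
  · constructor
    · intro h a ha
      refine (AddSubgroup.closure_le (AddSubgroup.ofClass P.ideal)).2 ?_
        (LPA.mem_vertexSums hG (I ⊓ J) ha)
      rintro _ ⟨v, u, w, hv, rfl⟩
      -- A generating vertex v of the meet lies in both `I` and `J`, so v = v v is a product of an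
      -- element of `I` and one of `J`.
      rw [← LPA.vtx_mul_vtx_self]
      refine P.ideal.mul_mem_right _ _ (P.ideal.mul_mem_left _ _ (h _ ?_ _ ?_))
      · exact (inf_le_left : I ⊓ J ≤ I) hv
      · exact (inf_le_right : I ⊓ J ≤ J) hv
    · exact fun h a ha b hb => h (mul_mem_core ha hb)

theorem IsPrime.map {V' E' : Type*} {F : DirGraph V' E'} (hG : G.RowFinite) (hF : F.RowFinite)
    (Φ : GradedIdeal k G ≃o GradedIdeal k F) {P : GradedIdeal k G} (hP : P.IsPrime) :
    (Φ P).IsPrime := by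
  rw [isPrime_iff hG] at hP
  rw [isPrime_iff hF]
  obtain ⟨⟨Q, hQ⟩, h⟩ := hP
  refine ⟨⟨Φ Q, fun h' => hQ (Φ.le_iff_le.1 h')⟩, fun I J hIJ => ?_⟩
  obtain ⟨I, rfl⟩ := Φ.surjective I
  obtain ⟨J, rfl⟩ := Φ.surjective J
  rw [← map_inf, Φ.le_iff_le] at hIJ
  rw [Φ.le_iff_le, Φ.le_iff_le]
  exact h I J hIJ

end GradedIdeal

/-! ### The induced homeomorphism of graded spectra -/

namespace GrSpec

variable {k : Type*} [Field k] {V E V' E' : Type*} {G : DirGraph V E} {F : DirGraph V' E'}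

/-- The map of graded spectra induced by an isomorphism of lattices of graded ideals. -/
def map (hG : G.RowFinite) (hF : F.RowFinite) (Φ : GradedIdeal k G ≃o GradedIdeal k F)
    (P : GrSpec k G) : GrSpec k F :=
  ⟨Φ P.toGradedIdeal, P.2.map hG hF Φ⟩

/-- The preimage of W(I) is W(Φ⁻¹ I), because I ≤ Φ P is equivalent to Φ⁻¹ I ≤ P. -/
theorem continuous_map (hG : G.RowFinite) (hF : F.RowFinite)
    (Φ : GradedIdeal k G ≃o GradedIdeal k F) : Continuous (map hG hF Φ) := by
  refine continuous_def.2 ?_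
  rintro _ ⟨I, rfl⟩
  refine ⟨Φ.symm I, Set.ext fun P => not_congr ?_⟩
  exact Φ.symm_apply_le.symm

/-- The homeomorphism of graded spectra induced by an isomorphism of lattices of graded ideals. -/
def homeomorph (hG : G.RowFinite) (hF : F.RowFinite) (Φ : GradedIdeal k G ≃o GradedIdeal k F) :
    GrSpec k G ≃ₜ GrSpec k F where
  toFun := map hG hF Φ
  invFun := map hF hG Φ.symm
  left_inv P := Subtype.ext (Φ.symm_apply_apply P.1)
  right_inv P := Subtype.ext (Φ.apply_symm_apply P.1)
  continuous_toFun := continuous_map hG hF Φ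
  continuous_invFun := continuous_map hF hG Φ.symm

end GrSpec

end

theorem mainTheorem9 {k : Type*} [Field k] {V₁ E₁ V₂ E₂ : Type*}
    (E : DirGraph V₁ E₁) (F : DirGraph V₂ E₂) (hE : E.RowFinite) (hF : F.RowFinite)
    (φ : K0gr (LPA.grading k E) ≃ₗ[LaurentPolynomial ℤ] K0gr (LPA.grading k F))
    (hφ : ∀ a b, φ a ≤ φ b ↔ a ≤ b) :
    ∃ Φ : GradedIdeal k E ≃o GradedIdeal k F,
      (∀ I : GradedIdeal k E, (Φ I).vgr = φ '' I.vgr) ∧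
      ∃ Ψ : GrSpec k E ≃ₜ GrSpec k F, ∀ P, (Ψ P).toGradedIdeal = Φ P.toGradedIdeal := by
  refine ⟨(GradedIdeal.orderIsoOrderIdeals hE).trans ((K0gr.orderIdealIso φ hφ).trans
    (GradedIdeal.orderIsoOrderIdeals hF).symm), fun I => ?_, GrSpec.homeomorph hE hF _,
    fun _ => rfl⟩
  -- By construction Φ I is the ideal attached to the order ideal φ(`I.vgr`), so its `vgr` gives
  -- that order ideal back.
  exact GradedIdeal.vgr_ofOrderIdeal hF ((I.isOrderIdeal_vgr hE).image φ hφ)
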